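/- **Proposition (weak-coupling limit of the current two-point function).** Setting. Let $p\ge 1$, $q\ge 0$ be integers, $\omega=e^{2\pi i/p}$, and let $b=(b_n)_{n\ge1}$ be complex numbers with $b_n=0$ for $n>p+q$. Let $\alpha_n$ ($n\in\mathbb Z$) be oscillators with $[\alpha_m,\alpha_n]=m\,\delta_{m+n,0}$, and for $g>0$ let $\langle b/g|=\langle 0|\exp\big(g^{-1}\sum_{n\ge1} b_n\alpha_n\big)$, so that $\langle b/g|\alpha_{-n}=g^{-1}n b_n\langle b/g|$ $(n\ge1)$ and $\langle b/g|\alpha_0=0$. Let $|\Phi\rangle$ be a state (which may depend on $g$), given by its matrix elements $\langle b/g|f(\alpha_1,\alpha_2,\dots)|\Phi\rangle$ with $f$ a polynomial, such that $\langle b/g|\Phi\rangle\neq0$ for small $g>0$. Write $\langle X\rangle=\langle b/g|X|\Phi\rangle/\langle b/g|\Phi\rangle$, and define the connected correlators of $\mathcal O_n$ by $\ln\,\langle e^{\sum_{n\ge1} j_n\alpha_n}\rangle=\sum_{N\ge1}\frac1{N!}\sum_{n_1,\dots,n_N\ge1}j_{n_1}\cdots j_{n_N}\langle\mathcal O_{n_1}\cdots\mathcal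 O_{n_N}\rangle_c$. Assume that they have the genus expansion $\langle\mathcal O_{n_1}\cdots\mathcal O_{n_N}\rangle_c=\sum_{h\ge0}g^{2h+N-2}\langle\mathcal O_{n_1}\cdots\mathcal O_{n_N}\rangle_c^{(h)}$ for all $N\ge 1$, as an asymptotic expansion for $g\to0^+$. Fields. Let $\varphi_a$ $(0\le a<p)$ be the twisted bosons with $\partial\varphi_a(\zeta)=\frac1p\sum_{n}\omega^{-na}\alpha_n\zeta^{-n/p-1}$. Let $:\ :$ be the normal ordering with $:\!\varphi_a(\zeta_1)\varphi_b(\zeta_2)\!:\,=\varphi_a(\zeta_1)\varphi_b(\zeta_2)-\delta_{ab}\ln(\zeta_1-\zeta_2)$ (radially ordered products), and let $W^s(\zeta)=\sum_{a=0}^{p-1}:\!e^{-\varphi_a(\zeta)}\partial^s e^{\varphi_a(\zeta)}\!:$ for $s\ge1$. Let $\langle\langle W^s(\zeta_1)W^t(\zeta_2)\rangle\rangle_c$ be the expectation value of the radially ordered product of $W^s(\zeta_1)$ and $W^t(\zeta_2)$ minus $\langle W^s(\zeta_1)\rangle\langle W^t(\zeta_2)\rangle$. Amplitudes. With $\lambda_a=\omega^a\zeta^{1/p}$,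 let the disk and annulus amplitudes be $$Q_a(\zeta)=\frac1p\sum_{n=1}^{p+q}n b_n\omega^{na}\zeta^{n/p-1}+\frac1p\sum_{n\ge1}\langle\mathcal O_n\rangle^{(0)}\omega^{-na}\zeta^{-n/p-1},$$ $$\langle\partial\varphi_a(\zeta_1)\partial\varphi_b(\zeta_2)\rangle_c^{(0)}=\frac1{p^2}\sum_{n,m\ge1}\langle\mathcal O_n\mathcal O_m\rangle_c^{(0)}\omega^{-na-mb}\zeta_1^{-n/p-1}\zeta_2^{-m/p-1}+\frac{d\lambda_a}{d\zeta}(\zeta_1)\,\frac{d\lambda_b}{d\zeta}(\zeta_2)\,\frac{1}{(\lambda_a(\zeta_1)-\lambda_b(\zeta_2))^2}-\frac{\delta_{ab}}{(\zeta_1-\zeta_2)^2},$$ and put $$A_{ab}(\zeta_1,\zeta_2)=\langle\partial\varphi_a(\zeta_1)\partial\varphi_b(\zeta_2)\rangle_c^{(0)}+\frac{\delta_{ab}}{(\zeta_1-\zeta_2)^2}.$$ All functions of $\zeta_1,\zeta_2$ are identified with their double series in $\zeta_1^{\pm1/p},\zeta_2^{\pm1/p}$ in either of the regions $|\zeta_1|>|\zeta_2|$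 and $|\zeta_2|>|\zeta_1|$; limits and $O(\cdot)$ for $g\to0^+$ are meant coefficient by coefficient. Claim. $Q_a=\lim_{g\to0^+} g\,\langle\partial\varphi_a\rangle$, and the annulus amplitude above is $\lim_{g\to0^+}\big(\langle:\!\partial\varphi_a(\zeta_1)\partial\varphi_b(\zeta_2)\!:\rangle-\langle\partial\varphi_a(\zeta_1)\rangle\langle\partial\varphi_b(\zeta_2)\rangle\big)$. In each of the two regions, for all $s,t\ge1$, $$\langle\langle W^s(\zeta_1)W^t(\zeta_2)\rangle\rangle_c=\frac{st}{g^{s+t-2}}\sum_{a,b=0}^{p-1}Q_a^{s-1}(\zeta_1)A_{ab}(\zeta_1,\zeta_2)Q_b^{t-1}(\zeta_2)+O(g^{-s-t+3}),$$ and $$\sum_{a,b=0}^{p-1}Q_a^{s-1}(\zeta_1)A_{ab}(\zeta_1,\zeta_2)Q_b^{t-1}(\zeta_2)=p^2\big[Q_0^{s-1}(\zeta_1)A_{00}(\zeta_1,\zeta_2)Q_0^{t-1}(\zeta_2)\big]_{\rm int},$$ where $\big[\sum_{m,n\in\mathbb Z}f_{m,n}\zeta_1^{m/p}\zeta_2^{n/p}\big]_{\rm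 int}=\sum_{k,l\in\mathbb Z}f_{kp,lp}\zeta_1^k\zeta_2^l$. -/

import Mathlib

open Filter Topology Asymptotics

noncomputable section

namespace MinimalString

/-! ### Oscillators and correlation functions

A state `|Φ⟩` enters only through the matrix elements `⟨b/g| f(α₁, α₂, …) |Φ⟩`, where `f` is a
polynomial in the mutually commuting positive modes and `⟨b/g| = ⟨0| exp (g⁻¹ ∑ bₙ αₙ)`. So bras are
polynomials `f` (standing for `⟨b/g| f(α)`), and `|Φ⟩` is a linear form on them. -/

/-- The space of bras `⟨b/g| f(α₁, α₂, …)`; the variable `X n` is the mode `αₙ`, `n ≥ 1`. -/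
abbrev Bra : Type := MvPolynomial ℕ+ ℂ

/-- Right action `f ↦ f · αₙ` of the oscillator `αₙ` on bras built over the coherent state `⟨x|`,
where `⟨x| α₋ₙ = n xₙ ⟨x|`, `⟨x| α₀ = 0` and `[αₘ, αₙ] = m δ_{m+n,0}`. -/
def mode (x : ℕ+ → ℂ) : ℤ → Module.End ℂ Bra
  | Int.ofNat 0 => 0
  | Int.ofNat (n + 1) => LinearMap.mulLeft ℂ (MvPolynomial.X n.succPNat)
  | Int.negSucc n =>
      ((n : ℂ) + 1) • (x n.succPNat • LinearMap.id + (MvPolynomial.pderiv n.succPNat).toLinearMap)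

/-- Right action of the oscillator-normal-ordered product of the modes in `l`: creation operators
(negative modes) stand to the left, hence act first on a bra. -/
def modes (x : ℕ+ → ℂ) (l : List ℤ) : Module.End ℂ Bra :=
  ((l.filter (fun n => 0 ≤ n)).map (mode x)).prod * ((l.filter (fun n => n < 0)).map (mode x)).prod

/-- The normalized matrix element `⟨b/g| f(α) |Φ⟩ / ⟨b/g|Φ⟩`. -/
def expect (Φ : Bra →ₗ[ℂ] ℂ) (f : Bra) : ℂ := Φ f / Φ 1

/-- `∏ μₙ!` for a multi-index `μ`. -/
def multiFactorial (μ : ℕ+ →₀ ℕ) : ℕ := μ.prod fun _ k => k.factorial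

/-- The generating function `Z(j) = ⟨b/g| exp (∑ jₙ αₙ) |Φ⟩ / ⟨b/g|Φ⟩` as a power series in `j`. -/
def genZ (Φ : Bra →ₗ[ℂ] ℂ) : MvPowerSeries ℕ+ ℂ := fun μ =>
  expect Φ (MvPolynomial.monomial μ 1) / (multiFactorial μ : ℂ)

/-- The coefficients of `F = ln Z = ∑_{k ≥ 1} (-1)^(k+1) (Z - 1)^k / k`. As `Z - 1` has no constant
term, only `k ≤ |μ|` contribute to the coefficient of `j^μ`. -/
def logZ (Φ : Bra →ₗ[ℂ] ℂ) : MvPowerSeries ℕ+ ℂ := fun μ =>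
  ∑ k ∈ Finset.Icc 1 μ.degree, (-1 : ℂ) ^ (k + 1) / (k : ℂ) * MvPowerSeries.coeff μ ((genZ Φ - 1) ^ k)

/-- The connected correlation function `⟨∏ₙ 𝒪ₙ^(μₙ)⟩_c`, a derivative of `F = ln Z` at `j = 0`. -/
def connected (Φ : Bra →ₗ[ℂ] ℂ) (μ : ℕ+ →₀ ℕ) : ℂ :=
  (multiFactorial μ : ℂ) * MvPowerSeries.coeff μ (logZ Φ)

/-- The genus expansion `⟨𝒪_{n₁} ⋯ 𝒪_{n_N}⟩_c = ∑_{h ≥ 0} g^(2h+N-2) ⟨𝒪_{n₁} ⋯ 𝒪_{n_N}⟩_c^(h)`,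
`N ≥ 1`, as an asymptotic expansion for `g → 0⁺`; `v μ h` is the genus-`h` part. -/
def HasGenusExpansion (Φ : ℝ → Bra →ₗ[ℂ] ℂ) (v : (ℕ+ →₀ ℕ) → ℕ → ℂ) : Prop :=
  ∀ μ : ℕ+ →₀ ℕ, μ ≠ 0 → ∀ H : ℕ,
    (fun g : ℝ => connected (Φ g) μ
        - ∑ h ∈ Finset.range H, (g : ℂ) ^ (2 * (h : ℤ) + (μ.degree : ℤ) - 2) * v μ h)
      =O[𝓝[>] 0] fun g : ℝ => g ^ (2 * (H : ℤ) + (μ.degree : ℤ) - 2)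

/-! ### Twisted bosons and the currents

All fields are expanded in `u = ζ^(-1/p)`: "the coefficient at `m`" is the one of `ζ^(-m/p)`. -/

/-- `ω = exp (2πi/p)`. -/
def omega (p : ℕ) : ℂ := Complex.exp (2 * Real.pi * Complex.I / p)

/-- The coefficient of `αₙ ζ^(-n/p-k)` in `∂ᵏφₐ(ζ)`, `k ≥ 1`, where
`∂φₐ(ζ) = p⁻¹ ∑ₙ ω^(-na) αₙ ζ^(-n/p-1)`. -/
def fieldCoeff (p a k : ℕ) (n : ℤ) : ℂ :=
  (p : ℂ)⁻¹ * omega p ^ (-n * (a : ℤ)) * ∏ i ∈ Finset.range (k - 1), (-(n : ℂ) / p - ((i : ℂ) + 1))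

/-- Right action of the coefficient of `ζ^(-N/p - ∑ kᵢ)` in the oscillator-normal-ordered product of
`∂^(k₁)φₐ(ζ), …, ∂^(k_r)φₐ(ζ)`, `ks = [k₁, …, k_r]`. On a given bra, and for `x` of finite support,
only finitely many mode tuples contribute. -/
def oscOrdered (p : ℕ) (x : ℕ+ → ℂ) (a : ℕ) (ks : List ℕ) (N : ℤ) (f : Bra) : Bra :=
  ∑ᶠ n : {n : Fin ks.length → ℤ // ∑ i, n i = N},
    (∏ i, fieldCoeff p a (ks.get i) (n.1 i)) • modes x (List.ofFn n.1) f

/-- The difference of the two normal orderings (oscillators minus the `ζ`-plane) for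
`∂ᵏφₐ ∂ˡφₐ` at coinciding points is `wickConst p k l * ζ^(-k-l)`; it is the derivative at `x = y = 1`
of `ln ((x^(1/p) - y^(1/p)) / (x - y)) = - ln ∑_{i < p} x^(i/p) y^((p-1-i)/p)`. -/
def wickConst (p k l : ℕ) : ℝ :=
  iteratedDeriv k (fun x : ℝ => iteratedDeriv l (fun y : ℝ =>
    -Real.log (∑ i ∈ Finset.range p,
      x ^ ((i : ℝ) / (p : ℝ)) * y ^ (((p : ℝ) - 1 - (i : ℝ)) / (p : ℝ)))) 1) 1

/-- Wick expansion of the `ζ`-plane normal-ordered product `:∂^(k₁)φₐ ⋯ ∂^(k_r)φₐ:` into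
oscillator-normal-ordered ones: a sum over partial pairings, each given by its weight and the list of
unpaired factors. -/
def wick (p : ℕ) : List ℕ → List (ℂ × List ℕ)
  | [] => [(1, [])]
  | k :: ks =>
      (wick p ks).map (fun t => (t.1, k :: t.2)) ++
      (List.finRange ks.length).flatMap (fun j : Fin ks.length =>
        (wick p (ks.eraseIdx j)).map (fun t => ((wickConst p k (ks.get j) : ℂ) * t.1, t.2)))
termination_by l => l.length
decreasing_by
  · simp
  · have := j.2
    simp only [List.length_eraseIdx, List.length_cons]
    split <;> omega

/-- The monomials (with repetition) of `e^(-φ) ∂ˢ e^φ`, from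
`e^(-φ) ∂^(s+1) e^φ = (∂φ + ∂) (e^(-φ) ∂ˢ e^φ)`; the list `[k₁, …, k_r]` is `∂^(k₁)φ ⋯ ∂^(k_r)φ`. -/
def bellMonomials : ℕ → List (List ℕ)
  | 0 => [[]]
  | s + 1 => (bellMonomials s).flatMap fun ks =>
      (1 :: ks) :: (List.finRange ks.length).map (fun j : Fin ks.length => ks.modify j (· + 1))

/-- Right action of the coefficient of `ζ^(-m/p)` in `𝒲ₐˢ(ζ) = :e^(-φₐ(ζ)) ∂ˢ e^(φₐ(ζ)):`, where
`: :` is the normal ordering of the `ζ`-plane. In particular `𝒲ₐ¹ = ∂φₐ`. -/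
def sheetCurrent (p : ℕ) (x : ℕ+ → ℂ) (a s : ℕ) (m : ℤ) (f : Bra) : Bra :=
  ((bellMonomials s).map fun ks =>
    ((wick p ks).map fun t => t.1 • oscOrdered p x a t.2 (m - (p : ℤ) * (s : ℤ)) f).sum).sum

/-- Right action of the coefficient of `ζ^(-m/p)` in `Wˢ(ζ) = ∑ₐ 𝒲ₐˢ(ζ)`. -/
def current (p : ℕ) (x : ℕ+ → ℂ) (s : ℕ) (m : ℤ) (f : Bra) : Bra :=
  ∑ a ∈ Finset.range p, sheetCurrent p x a s m f

/-- The regions I: `|ζ₁| > |ζ₂|` and II: `|ζ₂| > |ζ₁|`. -/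
inductive Region
  | I
  | II

/-- The coefficient of `ζ₁^(-m/p) ζ₂^(-n/p)` in the radially ordered `⟨⟨A(ζ₁) B(ζ₂)⟩⟩`, expanded in
the given region. A product `AB` acts on a bra by `A` first. -/
def radial (r : Region) (Φ : Bra →ₗ[ℂ] ℂ) (A B : ℤ → Bra → Bra) (m n : ℤ) : ℂ :=
  match r with
  | Region.I => expect Φ (B n (A m 1))
  | Region.II => expect Φ (A m (B n 1))

/-- The same for `⟨⟨A(ζ₁) B(ζ₂)⟩⟩_c = ⟨⟨A(ζ₁) B(ζ₂)⟩⟩ - ⟨A(ζ₁)⟩ ⟨B(ζ₂)⟩`. -/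
def radialConn (r : Region) (Φ : Bra →ₗ[ℂ] ℂ) (A B : ℤ → Bra → Bra) (m n : ℤ) : ℂ :=
  radial r Φ A B m n - expect Φ (A m 1) * expect Φ (B n 1)

/-! ### Laurent expansions in one and in two variables -/

/-- Laurent series in `u = ζ^(-1/p)`. -/
abbrev Series₁ : Type := LaurentSeries ℂ

/-- Expansions in two variables: Laurent series in the outer variable (the one with larger `|ζ|`)
over the field of Laurent series in the inner variable. -/
abbrev Series₂ : Type := LaurentSeries (LaurentSeries ℂ)

/-- A series in the inner variable. -/
def inner' (f : Series₁) : Series₂ := HahnSeries.C f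

/-- A series in the outer variable. -/
def outer' (f : Series₁) : Series₂ := f.map (HahnSeries.C : ℂ →+* LaurentSeries ℂ)

/-- `f(ζ₁)` in the given region. -/
def at₁ : Region → Series₁ → Series₂
  | Region.I => outer'
  | Region.II => inner'

/-- `f(ζ₂)` in the given region. -/
def at₂ : Region → Series₁ → Series₂
  | Region.I => inner'
  | Region.II => outer'

/-- The coefficient of `ζ₁^(-m/p) ζ₂^(-n/p)`. -/
def coeff₂ (r : Region) (F : Series₂) (m n : ℤ) : ℂ :=
  match r with
  | Region.I => (F.coeff m).coeff n
  | Region.II => (F.coeff n).coeff m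

/-- The double power series `∑_{i,j ≥ 0} c i j u₁ⁱ u₂ʲ`. -/
def double (r : Region) (c : ℕ → ℕ → ℂ) : Series₂ :=
  match r with
  | Region.I => HahnSeries.ofPowerSeries ℤ (LaurentSeries ℂ) (PowerSeries.mk fun i =>
      HahnSeries.ofPowerSeries ℤ ℂ (PowerSeries.mk fun j => c i j))
  | Region.II => HahnSeries.ofPowerSeries ℤ (LaurentSeries ℂ) (PowerSeries.mk fun j =>
      HahnSeries.ofPowerSeries ℤ ℂ (PowerSeries.mk fun i => c i j))

/-- The part of a series consisting of the integer powers of `ζ`. -/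
def intPart₁ {R : Type} [Zero R] (p : ℕ) (f : LaurentSeries R) : LaurentSeries R where
  coeff m := if (p : ℤ) ∣ m then f.coeff m else 0
  isPWO_support' := f.isPWO_support.mono fun m hm => by
    by_cases h : (p : ℤ) ∣ m <;> simp_all [Function.mem_support]

/-- The integer-power part `[F(ζ₁, ζ₂)]_int`: the terms with integer powers of both variables. -/
def intPart₂ (p : ℕ) (F : Series₂) : Series₂ where
  coeff m := if (p : ℤ) ∣ m then intPart₁ p (F.coeff m) else 0
  isPWO_support' := F.isPWO_support.mono fun m hm => by
    intro h
    apply hm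
    have h' : F.coeff m = 0 := h
    have h0 : intPart₁ p (0 : LaurentSeries ℂ) = 0 := by
      ext k
      simp [intPart₁]
    simp [h', h0]

/-! ### Disk and annulus amplitudes -/

/-- `ζ` as a series. -/
def zetaS (p : ℕ) : Series₁ := HahnSeries.single (-(p : ℤ)) 1

/-- `λₐ = ωᵃ λ`, `λ = ζ^(1/p)`. -/
def lamS (p a : ℕ) : Series₁ := HahnSeries.single (-1 : ℤ) (omega p ^ a)

/-- `dλₐ/dζ = ωᵃ p⁻¹ ζ^(1/p-1)`. -/
def dlamS (p a : ℕ) : Series₁ := HahnSeries.single ((p : ℤ) - 1) (omega p ^ a / p)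

/-- The disk amplitude `Qₐ(ζ) = ⟨∂φₐ(ζ)⟩^(0)`, namely
`p⁻¹ ∑_{n=1}^{p+q} n bₙ ω^(na) ζ^(n/p-1) + p⁻¹ ∑_{n ≥ 1} ⟨𝒪ₙ⟩^(0) ω^(-na) ζ^(-n/p-1)`. -/
def disk (p q : ℕ) (b : ℕ+ → ℂ) (v : (ℕ+ →₀ ℕ) → ℕ → ℂ) (a : ℕ) : Series₁ :=
  (∑ n ∈ Finset.range (p + q), HahnSeries.single ((p : ℤ) - ((n : ℤ) + 1))
      ((p : ℂ)⁻¹ * ((n : ℂ) + 1) * b n.succPNat * omega p ^ ((n + 1) * a)))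
  + HahnSeries.single ((p : ℤ) + 1) (1 : ℂ) *
    HahnSeries.ofPowerSeries ℤ ℂ (PowerSeries.mk fun n =>
      (p : ℂ)⁻¹ * v (Finsupp.single n.succPNat 1) 0 * omega p ^ (-((n : ℤ) + 1) * (a : ℤ)))

/-- `δ_{ab} / (ζ₁ - ζ₂)²`, expanded in the given region. -/
def deltaTerm (p : ℕ) (r : Region) (a b : ℕ) : Series₂ :=
  if a = b then ((at₁ r (zetaS p) - at₂ r (zetaS p)) ^ 2)⁻¹ else 0

/-- The annulus amplitude `⟨∂φₐ(ζ₁) ∂φ_c(ζ₂)⟩_c^(0)`, namely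
`p⁻² ∑_{n,m ≥ 1} ⟨𝒪ₙ𝒪ₘ⟩_c^(0) ω^(-na-mc) ζ₁^(-n/p-1) ζ₂^(-m/p-1)` plus the irregular term
`(dλₐ/dζ)(ζ₁) (dλ_c/dζ)(ζ₂) / (λₐ(ζ₁) - λ_c(ζ₂))² - δ_{ac} / (ζ₁ - ζ₂)²`. -/
def annulus (p : ℕ) (v : (ℕ+ →₀ ℕ) → ℕ → ℂ) (r : Region) (a c : ℕ) : Series₂ :=
  at₁ r (HahnSeries.single ((p : ℤ) + 1) 1) * at₂ r (HahnSeries.single ((p : ℤ) + 1) 1) *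
    double r (fun n m => ((p : ℂ) ^ 2)⁻¹ *
      v (Finsupp.single n.succPNat 1 + Finsupp.single m.succPNat 1) 0 *
      omega p ^ (-((n : ℤ) + 1) * (a : ℤ) - ((m : ℤ) + 1) * (c : ℤ)))
  + at₁ r (dlamS p a) * at₂ r (dlamS p c) * ((at₁ r (lamS p a) - at₂ r (lamS p c)) ^ 2)⁻¹
  - deltaTerm p r a c

/-- `A_{ac}(ζ₁, ζ₂) = ⟨∂φₐ(ζ₁) ∂φ_c(ζ₂)⟩_c^(0) + δ_{ac} / (ζ₁ - ζ₂)²`. -/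
def ampA (p : ℕ) (v : (ℕ+ →₀ ℕ) → ℕ → ℂ) (r : Region) (a c : ℕ) : Series₂ :=
  annulus p v r a c + deltaTerm p r a c

/-- `Qₐ^(s-1)(ζ₁) A_{ac}(ζ₁, ζ₂) Q_c^(t-1)(ζ₂)`. -/
def leadingTerm (p q : ℕ) (b : ℕ+ → ℂ) (v : (ℕ+ →₀ ℕ) → ℕ → ℂ) (r : Region) (s t a c : ℕ) :
    Series₂ :=
  at₁ r (disk p q b v a ^ (s - 1)) * ampA p v r a c * at₂ r (disk p q b v c ^ (t - 1))

/-- The background `b/g`. -/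
def background (b : ℕ+ → ℂ) (g : ℝ) : ℕ+ → ℂ := fun n => b n / (g : ℂ)

end MinimalString

end

noncomputable section

namespace MinimalString

section

/-! ### Moments and cumulants -/

/-! The divergences at weak coupling come from the background b/g and from the one-point functions,
which are also of order 1/g. Both become explicit classical values after the translation `X n ↦ X n
- onePoint v g n`: on translated bras, g αₙ acts as a number plus g times the mode in zero
background (`mode_shift`). After the translation every cumulant is bounded: the one-point functions
are O(g), and those of N ≥ 2 operators are O(g^(N-2)). Peeling off one variable at a time with Z ∂
ln Z = ∂Z then bounds the expectation value of every fixed translated polynomial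
(`expect_shift_isBigO_one`).

Hence gˢ times a current of spin s acts as d + g (e + T) + O(g²), where d and e are numbers and T is
linear in the modes (`HasExp`). Only the unpaired monomial (∂φₐ)ˢ contributes to d and T. Monomials
with fewer fields, whether from the Bell recursion or from Wick pairings, contribute only to e up to
this order (`hasExp_sheetCurrent`). Computing with a square-zero fluctuation identifies T with s
Qₐ^(s-1) ∂φₐ (`snd_coeff_symbolSeries_pow`). In the connected function d and e cancel, leaving g²
times the connected expectation value of T and T', up to O(g³) (`connected_isBigO`).

It remains to evaluate the two-point function of modes. Two positive modes give the genus-zero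
cumulant; a positive mode followed by a negative one gives their commutator. These commutators are
exactly the coefficients of the geometric expansion of the irregular term of A (`coeff_ampA`). The
second region follows by exchanging the two insertions.

For the last identity, the sheets are related by the rotation of ζ^(1/p) by roots of unity. Summing
over the rotations of both variables projects onto integer powers, with a factor p for each variable
(`sum_leadingTerm_I`). -/

lemma multiFactorial_add_single (μ : ℕ+ →₀ ℕ) (n : ℕ+) :
    multiFactorial (μ + Finsupp.single n 1) = (μ n + 1) * multiFactorial μ := by
  classical
  unfold multiFactorial
  rw [← Finsupp.mul_prod_erase' μ n (fun _ (k : ℕ) => k.factorial) (fun _ => by simp),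
    ← Finsupp.mul_prod_erase' (μ + Finsupp.single n 1) n (fun _ (k : ℕ) => k.factorial) (fun _ => by simp)]
  have h : (μ + Finsupp.single n 1).erase n = μ.erase n := by
    rw [Finsupp.erase_add, Finsupp.erase_single, add_zero]
  rw [h]
  simp [Nat.factorial_succ, mul_assoc]

lemma multiFactorial_single (n : ℕ+) : multiFactorial (Finsupp.single n 1) = 1 := by
  rw [← zero_add (Finsupp.single n 1), multiFactorial_add_single]
  simp [multiFactorial]

lemma multiFactorial_ne_zero (μ : ℕ+ →₀ ℕ) : (multiFactorial μ : ℂ) ≠ 0 := by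
  unfold multiFactorial
  exact_mod_cast Finset.prod_ne_zero_iff.mpr fun i _ => Nat.factorial_ne_zero _

/-- The pairing of polynomials with power series under which the multiplication by a variable
is adjoint to the derivative. -/
def pairing (S : MvPowerSeries ℕ+ ℂ) : Bra →ₗ[ℂ] ℂ :=
  (MvPolynomial.basisMonomials ℕ+ ℂ).constr ℂ
    fun μ => (multiFactorial μ : ℂ) * MvPowerSeries.coeff μ S

lemma pairing_monomial (S : MvPowerSeries ℕ+ ℂ) (μ : ℕ+ →₀ ℕ) :
    pairing S (MvPolynomial.monomial μ 1) =
      (multiFactorial μ : ℂ) * MvPowerSeries.coeff μ S := by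
  have := (MvPolynomial.basisMonomials ℕ+ ℂ).constr_basis ℂ
    (fun μ => (multiFactorial μ : ℂ) * MvPowerSeries.coeff μ S) μ
  simpa [pairing] using this

lemma bra_linearMap_ext {L L' : Bra →ₗ[ℂ] ℂ}
    (h : ∀ μ, L (MvPolynomial.monomial μ 1) = L' (MvPolynomial.monomial μ 1)) : L = L' :=
  (MvPolynomial.basisMonomials ℕ+ ℂ).ext fun μ => by simpa using h μ

lemma pairing_add (S T : MvPowerSeries ℕ+ ℂ) : pairing (S + T) = pairing S + pairing T :=
  bra_linearMap_ext fun μ => by simp [pairing_monomial, mul_add]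

lemma pairing_smul (c : ℂ) (S : MvPowerSeries ℕ+ ℂ) : pairing (c • S) = c • pairing S :=
  bra_linearMap_ext fun μ => by simp [pairing_monomial, mul_left_comm]

/-- Raising the exponent of the variable `n` multiplies the multi-factorial by `μ n + 1`, which is
the factor produced by the derivative. -/
lemma pairing_X_mul (S : MvPowerSeries ℕ+ ℂ) (n : ℕ+) (f : Bra) :
    pairing S (MvPolynomial.X n * f) = pairing (MvPowerSeries.pderiv ℂ n S) f := by
  have : pairing S ∘ₗ LinearMap.mulLeft ℂ (MvPolynomial.X n) =
      pairing (MvPowerSeries.pderiv ℂ n S) := by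
    refine bra_linearMap_ext fun μ => ?_
    have h : (MvPolynomial.X n : Bra) * MvPolynomial.monomial μ 1 =
        MvPolynomial.monomial (μ + Finsupp.single n 1) 1 := by
      rw [MvPolynomial.X, MvPolynomial.monomial_mul, add_comm, one_mul]
    rw [LinearMap.comp_apply, LinearMap.mulLeft_apply, h, pairing_monomial, pairing_monomial,
      MvPowerSeries.coeff_pderiv, multiFactorial_add_single]
    push_cast
    ring
  exact LinearMap.congr_fun this f

/-- The normalized matrix element as a linear form. -/
def expectL (Φ : Bra →ₗ[ℂ] ℂ) : Bra →ₗ[ℂ] ℂ := (Φ 1)⁻¹ • Φ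

lemma expectL_apply (Φ : Bra →ₗ[ℂ] ℂ) (f : Bra) : expectL Φ f = expect Φ f := by
  simp [expectL, expect, div_eq_inv_mul]

lemma coeff_genZ (Φ : Bra →ₗ[ℂ] ℂ) (μ : ℕ+ →₀ ℕ) : MvPowerSeries.coeff μ (genZ Φ) =
    expect Φ (MvPolynomial.monomial μ 1) / (multiFactorial μ : ℂ) := rfl

lemma coeff_logZ (Φ : Bra →ₗ[ℂ] ℂ) (μ : ℕ+ →₀ ℕ) : MvPowerSeries.coeff μ (logZ Φ) =
    ∑ k ∈ Finset.Icc 1 μ.degree,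
      (-1 : ℂ) ^ (k + 1) / (k : ℂ) * MvPowerSeries.coeff μ ((genZ Φ - 1) ^ k) := rfl

lemma pairing_genZ (Φ : Bra →ₗ[ℂ] ℂ) : pairing (genZ Φ) = expectL Φ :=
  bra_linearMap_ext fun μ => by
    rw [pairing_monomial, coeff_genZ, expectL_apply,
      mul_div_cancel₀ _ (multiFactorial_ne_zero μ)]

lemma expect_one {Φ : Bra →ₗ[ℂ] ℂ} (h : Φ 1 ≠ 0) : expect Φ 1 = 1 := div_self h

lemma coeff_zero_genZ {Φ : Bra →ₗ[ℂ] ℂ} (h : Φ 1 ≠ 0) :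
    MvPowerSeries.coeff 0 (genZ Φ) = 1 := by
  have : (MvPolynomial.monomial 0 1 : Bra) = 1 := rfl
  rw [coeff_genZ, this, expect_one h]
  simp [multiFactorial]

lemma constantCoeff_genZ_sub_one {Φ : Bra →ₗ[ℂ] ℂ} (h : Φ 1 ≠ 0) :
    MvPowerSeries.constantCoeff (genZ Φ - 1) = 0 := by
  rw [map_sub, ← MvPowerSeries.coeff_zero_eq_constantCoeff_apply, coeff_zero_genZ h]
  simp

lemma coeff_pow_eq_zero_of_degree_lt {U : MvPowerSeries ℕ+ ℂ}
    (hU : MvPowerSeries.constantCoeff U = 0) {μ : ℕ+ →₀ ℕ} {k : ℕ} (h : μ.degree < k) :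
    MvPowerSeries.coeff μ (U ^ k) = 0 :=
  MvPowerSeries.coeff_of_lt_order
    (lt_of_lt_of_le (by exact_mod_cast h) (MvPowerSeries.le_order_pow_of_constantCoeff_eq_zero k hU))

/-- The partial sums of the logarithmic series. -/
def logPartial (U : MvPowerSeries ℕ+ ℂ) (K : ℕ) : MvPowerSeries ℕ+ ℂ :=
  ∑ k ∈ Finset.Icc 1 K, ((-1 : ℂ) ^ (k + 1) / (k : ℂ)) • U ^ k

/-- The cutoff in `logZ` depends on the multi-index. Differentiation needs one partial sum valid for
several multi-indices, so the cutoff is raised; the extra powers have no terms of such low degree.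
-/
lemma coeff_logZ_eq_logPartial {Φ : Bra →ₗ[ℂ] ℂ} (h : Φ 1 ≠ 0) {μ : ℕ+ →₀ ℕ} {K : ℕ}
    (hK : μ.degree ≤ K) :
    MvPowerSeries.coeff μ (logZ Φ) = MvPowerSeries.coeff μ (logPartial (genZ Φ - 1) K) := by
  rw [coeff_logZ, logPartial, map_sum]
  refine Finset.sum_subset_zero_on_sdiff (Finset.Icc_subset_Icc_right hK) (fun k hk => ?_)
    fun k _ => by rw [MvPowerSeries.coeff_smul]
  simp only [Finset.mem_sdiff, Finset.mem_Icc] at hk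
  rw [MvPowerSeries.coeff_smul,
    coeff_pow_eq_zero_of_degree_lt (constantCoeff_genZ_sub_one h) (by omega), mul_zero]

/-- Differentiating the partial sum of ln(1 + U) gives ∂U times a finite geometric series in -U,
which telescopes against 1 + U. -/
lemma one_add_mul_pderiv_logPartial (U : MvPowerSeries ℕ+ ℂ) (K : ℕ) (n : ℕ+) :
    (1 + U) * MvPowerSeries.pderiv ℂ n (logPartial U K) =
      MvPowerSeries.pderiv ℂ n U * (1 - (-U) ^ K) := by
  induction K with
  | zero => simp [logPartial]
  | succ K ih =>
    have : logPartial U (K + 1) =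
        logPartial U K + ((-1 : ℂ) ^ K / ((K : ℂ) + 1)) • U ^ (K + 1) := by
      rw [logPartial, Finset.sum_Icc_succ_top (by omega), logPartial]
      simp [pow_succ]
    have hK : (K : ℂ) + 1 ≠ 0 := by exact_mod_cast K.succ_ne_zero
    have hd : MvPowerSeries.pderiv ℂ n (((-1 : ℂ) ^ K / ((K : ℂ) + 1)) • U ^ (K + 1)) =
        (-U) ^ K * MvPowerSeries.pderiv ℂ n U := by
      rw [Derivation.map_smul, Derivation.leibniz_pow, Nat.add_sub_cancel, ← Nat.cast_smul_eq_nsmul ℂ,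
        smul_smul]
      push_cast
      rw [div_mul_cancel₀ _ hK, neg_pow U K, smul_eq_mul, ← smul_mul_assoc]
      congr 1
      rw [MvPowerSeries.smul_eq_C_mul]
      simp
    rw [this, map_add, mul_add, ih, hd]
    ring

/-- `Z ∂ ln Z = ∂ Z`. -/
lemma genZ_mul_pderiv_logZ {Φ : Bra →ₗ[ℂ] ℂ} (h : Φ 1 ≠ 0) (n : ℕ+) :
    genZ Φ * MvPowerSeries.pderiv ℂ n (logZ Φ) = MvPowerSeries.pderiv ℂ n (genZ Φ) := by
  classical
  ext μ
  set U := genZ Φ - 1 with hU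
  have hZ : genZ Φ = 1 + U := by rw [hU]; ring
  have hU0 := constantCoeff_genZ_sub_one h
  have key := congrArg (MvPowerSeries.coeff μ)
    (one_add_mul_pderiv_logPartial U (μ.degree + 1) n)
  -- The cutoff is `μ.degree + 1` because the derivative reads coefficients one degree higher.
  have h1 : MvPowerSeries.coeff μ (genZ Φ * MvPowerSeries.pderiv ℂ n (logZ Φ)) =
      MvPowerSeries.coeff μ (genZ Φ * MvPowerSeries.pderiv ℂ n (logPartial U (μ.degree + 1))) := by
    rw [MvPowerSeries.coeff_mul, MvPowerSeries.coeff_mul]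
    refine Finset.sum_congr rfl fun x hx => ?_
    rw [MvPowerSeries.coeff_pderiv, MvPowerSeries.coeff_pderiv,
      coeff_logZ_eq_logPartial h (K := μ.degree + 1)]
    rw [Finset.HasAntidiagonal.mem_antidiagonal] at hx
    rw [← hx]
    simp only [map_add, Finsupp.degree_single]
    omega
  rw [h1, hZ, key, mul_sub, mul_one, map_sub, sub_eq_self.mpr]
  · rw [map_add]; simp
  -- The telescoping error contains `(-U) ^ (μ.degree + 1)`, which starts above the degree of `μ`.
  · rw [MvPowerSeries.coeff_mul]
    refine Finset.sum_eq_zero fun x hx => ?_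
    rw [Finset.HasAntidiagonal.mem_antidiagonal] at hx
    rw [coeff_pow_eq_zero_of_degree_lt (by rw [map_neg, hU0, neg_zero]), mul_zero]
    rw [← hx]
    simp only [map_add]
    omega

/-- The translation `Xₙ ↦ Xₙ - cₙ`. -/
def shift (c : ℕ+ → ℂ) : Bra →ₐ[ℂ] Bra :=
  MvPolynomial.aeval fun n => MvPolynomial.X n - MvPolynomial.C (c n)

lemma shift_X (c : ℕ+ → ℂ) (n : ℕ+) :
    shift c (MvPolynomial.X n) = MvPolynomial.X n - MvPolynomial.C (c n) := by
  simp [shift]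

lemma pderiv_shift (c : ℕ+ → ℂ) (n : ℕ+) (f : Bra) :
    MvPolynomial.pderiv n (shift c f) = shift c (MvPolynomial.pderiv n f) := by
  induction f using MvPolynomial.induction_on with
  | C a =>
    rw [MvPolynomial.pderiv_C, map_zero, ← MvPolynomial.algebraMap_eq, AlgHom.commutes,
      MvPolynomial.algebraMap_eq, MvPolynomial.pderiv_C]
  | add f g hf hg => simp [hf, hg]
  | mul_X f i hf =>
    rw [map_mul, shift_X, Derivation.leibniz, Derivation.leibniz, hf, map_sub,
      MvPolynomial.pderiv_C, sub_zero, map_add, smul_eq_mul, smul_eq_mul, smul_eq_mul,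
      smul_eq_mul, map_mul, map_mul, shift_X]
    congr 2
    rcases eq_or_ne i n with rfl | hin
    · simp
    · simp [MvPolynomial.pderiv_X_of_ne hin]

/-! ### Bounded moments from bounded cumulants -/

lemma isBigO_one_sum {ι : Type*} {l : Filter ℝ} {s : Finset ι} {f : ι → ℝ → ℂ}
    (h : ∀ i ∈ s, f i =O[l] fun _ => (1 : ℝ)) :
    (fun g => ∑ i ∈ s, f i g) =O[l] fun _ => (1 : ℝ) :=
  IsBigO.fun_sum h

lemma isBigO_one_mul {l : Filter ℝ} {f f' : ℝ → ℂ}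
    (h : f =O[l] fun _ => (1 : ℝ)) (h' : f' =O[l] fun _ => (1 : ℝ)) :
    (fun g => f g * f' g) =O[l] fun _ => (1 : ℝ) := by
  simpa using h.mul h'

/-- If the logarithmic derivatives of `Z`, shifted by `c`, have bounded coefficients, then the
shifted moments are bounded. -/
theorem pairing_shift_isBigO {l : Filter ℝ} {c : ℝ → ℕ+ → ℂ} {Z : ℝ → MvPowerSeries ℕ+ ℂ}
    {K : ℝ → ℕ+ → MvPowerSeries ℕ+ ℂ}
    (hZ0 : ∀ᶠ g in l, MvPowerSeries.coeff 0 (Z g) = 1)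
    (hZ : ∀ᶠ g in l, ∀ n, MvPowerSeries.pderiv ℂ n (Z g) = Z g * (MvPowerSeries.C (c g n) + K g n))
    (hK : ∀ n μ, (fun g => MvPowerSeries.coeff μ (K g n)) =O[l] fun _ => (1 : ℝ)) (f : Bra) :
    ∀ G : ℝ → MvPowerSeries ℕ+ ℂ,
      (∀ μ, (fun g => MvPowerSeries.coeff μ (G g)) =O[l] fun _ => (1 : ℝ)) →
      (fun g => pairing (Z g * G g) (shift (c g) f)) =O[l] fun _ => (1 : ℝ) := by
  classical
  induction f using MvPolynomial.induction_on with
  | C a =>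
    intro G hG
    refine (isBigO_one_mul (isBigO_const_const a one_ne_zero l) (hG 0)).congr' ?_ .rfl
    filter_upwards [hZ0] with g hg
    have : (MvPolynomial.C a : Bra) = a • MvPolynomial.monomial 0 1 := by
      rw [MvPolynomial.smul_monomial, smul_eq_mul, mul_one, MvPolynomial.C_apply]
    rw [← MvPolynomial.algebraMap_eq, AlgHom.commutes, MvPolynomial.algebraMap_eq, this, map_smul,
      pairing_monomial]
    rw [MvPowerSeries.coeff_zero_eq_constantCoeff_apply] at hg ⊢
    rw [MvPowerSeries.coeff_zero_eq_constantCoeff_apply, map_mul, hg]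
    simp [multiFactorial]
  | add f f' hf hf' =>
    intro G hG
    simpa using (hf G hG).add (hf' G hG)
  | mul_X f n hf =>
    intro G hG
    -- Since ∂(ZG) = Z ((c + K) G + ∂G), the factor `X n - c n` is absorbed by replacing G with K G
    -- + ∂G, again bounded. This is why the induction is over all bounded G at once.
    refine (hf (fun g => K g n * G g + MvPowerSeries.pderiv ℂ n (G g)) fun μ => ?_).congr' ?_ .rfl
    · simp only [map_add, MvPowerSeries.coeff_mul, MvPowerSeries.coeff_pderiv]
      refine IsBigO.add (isBigO_one_sum fun i _ => isBigO_one_mul (hK _ _) (hG _)) ?_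
      exact isBigO_one_mul (hG _) (isBigO_const_const _ one_ne_zero l)
    · filter_upwards [hZ] with g hg
      rw [map_mul, shift_X, mul_sub, map_sub, mul_comm _ (MvPolynomial.X n), pairing_X_mul,
        mul_comm _ (MvPolynomial.C _), ← MvPolynomial.smul_eq_C_mul, map_smul, ← LinearMap.smul_apply,
        ← pairing_smul, ← LinearMap.sub_apply, sub_eq_add_neg, ← neg_one_smul ℂ (pairing _),
        ← pairing_smul, ← pairing_add]
      congr 2
      rw [Derivation.leibniz, hg n, neg_smul, one_smul, MvPowerSeries.smul_eq_C_mul, smul_eq_mul,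
        smul_eq_mul]
      ring

/-! ### Consequences of the genus expansion -/

lemma zpow_isBigO_one {k : ℤ} (hk : 0 ≤ k) :
    (fun g : ℝ => g ^ k) =O[𝓝[>] 0] fun _ => (1 : ℝ) := by
  lift k to ℕ using hk
  have : Tendsto (fun g : ℝ => g ^ (k : ℤ)) (𝓝[>] 0) (𝓝 (0 ^ k)) := by
    simp only [zpow_natCast]
    exact ((continuous_pow k).tendsto 0).mono_left nhdsWithin_le_nhds
  exact this.isBigO_one ℝ

variable {Φ : ℝ → Bra →ₗ[ℂ] ℂ} {v : (ℕ+ →₀ ℕ) → ℕ → ℂ}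

lemma HasGenusExpansion.connected_single_sub (hv : HasGenusExpansion Φ v) (n : ℕ+) :
    (fun g : ℝ => connected (Φ g) (Finsupp.single n 1) - v (Finsupp.single n 1) 0 / (g : ℂ))
      =O[𝓝[>] 0] fun g : ℝ => g := by
  simpa [Finsupp.degree_single, div_eq_inv_mul, zpow_neg] using
    hv (Finsupp.single n 1) (by simp) 1

/-- With no genus subtracted, the remainder bound is g^(N-2), where N is the degree. -/
lemma HasGenusExpansion.connected_isBigO_one (hv : HasGenusExpansion Φ v) {μ : ℕ+ →₀ ℕ}
    (hμ : 2 ≤ μ.degree) :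
    (fun g : ℝ => connected (Φ g) μ) =O[𝓝[>] 0] fun _ => (1 : ℝ) := by
  have h := hv μ (by rintro rfl; simp at hμ) 0
  simp only [Finset.range_zero, Finset.sum_empty, sub_zero] at h
  exact h.trans (zpow_isBigO_one (by push_cast; omega))

lemma HasGenusExpansion.connected_pair (hv : HasGenusExpansion Φ v) (n m : ℕ+) :
    (fun g : ℝ => connected (Φ g) (Finsupp.single n 1 + Finsupp.single m 1)
      - v (Finsupp.single n 1 + Finsupp.single m 1) 0) =O[𝓝[>] 0] fun g : ℝ => g := by
  have h := hv (Finsupp.single n 1 + Finsupp.single m 1) (by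
    intro h
    simpa using congrArg Finsupp.degree h) 1
  have h2 : (fun g : ℝ => g ^ (2 : ℤ)) =O[𝓝[>] 0] fun g : ℝ => g := by
    have := (zpow_isBigO_one zero_le_one).mul (isBigO_refl (fun g : ℝ => g) (𝓝[>] 0))
    simpa [sq, zpow_ofNat] using this
  refine IsBigO.trans ?_ h2
  simpa [Finsupp.degree_single] using h

/-- The genus-zero one-point functions in the background `b/g`. -/
def onePoint (v : (ℕ+ →₀ ℕ) → ℕ → ℂ) (g : ℝ) : ℕ+ → ℂ := fun n => v (Finsupp.single n 1) 0 / (g : ℂ)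

/-- The shifted moments of a fixed polynomial are bounded. -/
theorem expect_shift_isBigO_one (hΦ : ∀ᶠ g in 𝓝[>] (0 : ℝ), Φ g 1 ≠ 0)
    (hv : HasGenusExpansion Φ v) (f : Bra) :
    (fun g => expect (Φ g) (shift (onePoint v g) f)) =O[𝓝[>] 0] fun _ => (1 : ℝ) := by
  classical
  have := pairing_shift_isBigO (l := 𝓝[>] 0) (c := onePoint v) (Z := fun g => genZ (Φ g))
    (K := fun g n => MvPowerSeries.pderiv ℂ n (logZ (Φ g)) - MvPowerSeries.C (onePoint v g n))
    (hΦ.mono fun g hg => coeff_zero_genZ hg)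
    (hΦ.mono fun g hg n => by rw [add_sub_cancel, genZ_mul_pderiv_logZ hg]) ?_ f (fun _ => 1) ?_
  · refine this.congr_left fun g => ?_
    rw [mul_one, pairing_genZ, expectL_apply]
  · intro n μ
    have hF : ∀ ν g, MvPowerSeries.coeff ν (logZ (Φ g)) =
        connected (Φ g) ν * (multiFactorial ν : ℂ)⁻¹ := fun ν g => by
      rw [connected, mul_comm, inv_mul_cancel_left₀ (multiFactorial_ne_zero ν)]
    simp only [map_sub, MvPowerSeries.coeff_pderiv, MvPowerSeries.coeff_C, hF]
    -- The subtraction affects only the constant coefficient, which is the one-point function minus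
    -- its 1/g part. All other coefficients are cumulants of at least two operators.
    split_ifs with hμ
    · subst hμ
      have := (hv.connected_single_sub n).trans
        ((zpow_isBigO_one zero_le_one).congr_left fun g => zpow_one g)
      refine this.congr_left fun g => ?_
      rw [zero_add, multiFactorial_single]
      simp [onePoint]
    · simp only [sub_zero]
      refine isBigO_one_mul (isBigO_one_mul (hv.connected_isBigO_one ?_)
        (isBigO_const_const _ one_ne_zero _)) (isBigO_const_const _ one_ne_zero _)
      have : μ.degree ≠ 0 := by simpa [Finsupp.degree_eq_zero_iff] using hμ
      simp only [map_add, Finsupp.degree_single]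
      omega
  · intro μ
    exact isBigO_const_const _ one_ne_zero _

lemma connected_single (Ψ : Bra →ₗ[ℂ] ℂ) (n : ℕ+) :
    connected Ψ (Finsupp.single n 1) = expect Ψ (MvPolynomial.X n) := by
  have h0 : MvPowerSeries.coeff (Finsupp.single n 1) (1 : MvPowerSeries ℕ+ ℂ) = 0 := by
    classical
    rw [MvPowerSeries.coeff_one, if_neg (by simp)]
  rw [connected, coeff_logZ]
  simp [Finsupp.degree_single, multiFactorial_single, h0, coeff_genZ, MvPolynomial.X]

/-- Differentiating Z ∂ₘ ln Z = ∂ₘ Z once more and reading off the constant term gives the second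
moment as the cumulant plus the product of the means. -/
lemma connected_pair_eq {Ψ : Bra →ₗ[ℂ] ℂ} (h : Ψ 1 ≠ 0) (n m : ℕ+) :
    connected Ψ (Finsupp.single n 1 + Finsupp.single m 1) =
      expect Ψ (MvPolynomial.X n * MvPolynomial.X m) -
        expect Ψ (MvPolynomial.X n) * expect Ψ (MvPolynomial.X m) := by
  classical
  have key := congrArg (fun S => pairing S (MvPolynomial.X n)) (genZ_mul_pderiv_logZ h m)
  have e0 : ∀ S : MvPowerSeries ℕ+ ℂ, pairing S (MvPolynomial.X n) =
      MvPowerSeries.coeff 0 (MvPowerSeries.pderiv ℂ n S) := fun S => by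
    have : (MvPolynomial.X n : Bra) = MvPolynomial.X n * MvPolynomial.monomial 0 1 := by
      rw [MvPolynomial.monomial_zero', MvPolynomial.C_1, mul_one]
    rw [this, pairing_X_mul, pairing_monomial]
    simp [multiFactorial]
  rw [← pairing_X_mul, pairing_genZ, expectL_apply, e0, Derivation.leibniz, map_add, smul_eq_mul,
    smul_eq_mul] at key
  simp only [MvPowerSeries.coeff_zero_eq_constantCoeff_apply, map_mul] at key
  simp only [← MvPowerSeries.coeff_zero_eq_constantCoeff_apply] at key
  have e1 : MvPowerSeries.coeff 0 (MvPowerSeries.pderiv ℂ m (logZ Ψ)) =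
      expect Ψ (MvPolynomial.X m) := by
    rw [← connected_single, MvPowerSeries.coeff_pderiv, connected, zero_add]
    simp [multiFactorial_single]
  have e2 : MvPowerSeries.coeff 0 (MvPowerSeries.pderiv ℂ n (genZ Ψ)) =
      expect Ψ (MvPolynomial.X n) := by
    rw [← e0, pairing_genZ, expectL_apply]
  have e3 : MvPowerSeries.coeff 0 (MvPowerSeries.pderiv ℂ n (MvPowerSeries.pderiv ℂ m (logZ Ψ))) =
      connected Ψ (Finsupp.single n 1 + Finsupp.single m 1) := by
    rw [MvPowerSeries.coeff_pderiv, MvPowerSeries.coeff_pderiv, connected, zero_add,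
      multiFactorial_add_single]
    rw [multiFactorial_single]
    simp only [Finsupp.coe_zero, Pi.zero_apply]
    push_cast
    ring
  rw [e1, e2, e3, coeff_zero_genZ h] at key
  rw [mul_comm (MvPolynomial.X n), ← key]
  ring

end

section

/-! ### Families of bras that are polynomial in the coupling -/

/-- The genus-zero value of `g αₙ` in the background `b/g`. -/
def modeValue (b : ℕ+ → ℂ) (v : (ℕ+ →₀ ℕ) → ℕ → ℂ) : ℤ → ℂ
  | Int.ofNat 0 => 0
  | Int.ofNat (n + 1) => v (Finsupp.single n.succPNat 1) 0
  | Int.negSucc n => ((n : ℂ) + 1) * b n.succPNat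

/-- For a positive mode, the value comes from writing multiplication by `X n` as the translated
variable plus `onePoint v g n`. For a negative one it comes from the background, as the derivative
commutes with translations. Either way both 1/g terms become a number. -/
lemma mode_shift (b : ℕ+ → ℂ) (v : (ℕ+ →₀ ℕ) → ℕ → ℂ) {g : ℝ} (hg : g ≠ 0) (n : ℤ) (f : Bra) :
    mode (background b g) n (shift (onePoint v g) f) = (g : ℂ)⁻¹ • shift (onePoint v g)
      ((modeValue b v n • (1 : Module.End ℂ Bra) + (g : ℂ) • mode 0 n) f) := by
  have hg' : (g : ℂ) ≠ 0 := by exact_mod_cast hg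
  match n with
  | Int.ofNat 0 => simp [mode, modeValue]
  | Int.ofNat (n + 1) =>
    simp only [mode, modeValue, LinearMap.mulLeft_apply, LinearMap.add_apply, LinearMap.smul_apply,
      Module.End.one_apply, map_add, map_smul, map_mul, shift_X, smul_add, smul_smul]
    rw [inv_mul_cancel₀ hg', one_smul, sub_mul, onePoint, ← MvPolynomial.smul_eq_C_mul,
      div_eq_inv_mul]
    abel
  | Int.negSucc n =>
    simp only [mode, modeValue, LinearMap.add_apply, LinearMap.smul_apply, Pi.zero_apply,
      Module.End.one_apply, map_add, map_smul, smul_add, smul_smul, LinearMap.id_apply, zero_smul,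
      zero_add, Derivation.coeFn_coe, pderiv_shift, background]
    rw [← mul_assoc _ (g : ℂ), inv_mul_cancel₀ hg', one_mul]
    congr 2
    ring

/-- The families of bras that depend polynomially on `g`. -/
def polyFamily : Submodule ℂ (ℝ → Bra) :=
  Submodule.span ℂ (Set.range fun kf : ℕ × Bra => fun g : ℝ => (g : ℂ) ^ kf.1 • kf.2)

lemma const_mem_polyFamily (f : Bra) : (fun _ => f) ∈ polyFamily :=
  Submodule.subset_span ⟨(0, f), by simp⟩

lemma coupling_smul_mem_polyFamily {F : ℝ → Bra} (hF : F ∈ polyFamily) :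
    (fun g : ℝ => (g : ℂ) • F g) ∈ polyFamily := by
  induction hF using Submodule.span_induction with
  | mem F hF =>
    obtain ⟨⟨k, f⟩, rfl⟩ := hF
    exact Submodule.subset_span ⟨(k + 1, f), by funext g; simp [smul_smul, pow_succ']⟩
  | zero =>
    simp only [Pi.zero_apply, smul_zero]
    exact polyFamily.zero_mem
  | add F F' _ _ h h' =>
    simp only [Pi.add_apply, smul_add]
    exact polyFamily.add_mem h h'
  | smul c F _ h =>
    simp only [Pi.smul_apply, smul_comm _ c]
    exact polyFamily.smul_mem c h

lemma map_mem_polyFamily (L : Module.End ℂ Bra) {F : ℝ → Bra} (hF : F ∈ polyFamily) :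
    (fun g => L (F g)) ∈ polyFamily := by
  induction hF using Submodule.span_induction with
  | mem F hF =>
    obtain ⟨⟨k, f⟩, rfl⟩ := hF
    exact Submodule.subset_span ⟨(k, L f), by simp⟩
  | zero =>
    simp only [Pi.zero_apply, map_zero]
    exact polyFamily.zero_mem
  | add F F' _ _ h h' =>
    simp only [Pi.add_apply, map_add]
    exact polyFamily.add_mem h h'
  | smul c F _ h =>
    simp only [Pi.smul_apply, map_smul]
    exact polyFamily.smul_mem c h

/-- Such a family involves only finitely many fixed bras with coefficients polynomial in g, so
bounds on fixed bras suffice for remainders that depend on g. -/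
lemma isBigO_one_of_mem_polyFamily {Ψ : ℝ → Bra →ₗ[ℂ] ℂ}
    (hΨ : ∀ f, (fun g => Ψ g f) =O[𝓝[>] 0] fun _ => (1 : ℝ)) {F : ℝ → Bra} (hF : F ∈ polyFamily) :
    (fun g => Ψ g (F g)) =O[𝓝[>] 0] fun _ => (1 : ℝ) := by
  induction hF using Submodule.span_induction with
  | mem F hF =>
    obtain ⟨⟨k, f⟩, rfl⟩ := hF
    have h : (fun g : ℝ => (g : ℂ) ^ k) =O[𝓝[>] 0] fun _ => (1 : ℝ) :=
      (zpow_isBigO_one (Int.natCast_nonneg k)).norm_left.congr_left (fun g => by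
        rw [zpow_natCast, norm_pow, norm_pow, Complex.norm_real]) |>.of_norm_left
    simpa using isBigO_one_mul h (hΨ f)
  | zero =>
    simp only [Pi.zero_apply, map_zero]
    exact isBigO_zero _ _
  | add F F' _ _ h h' => simpa using h.add h'
  | smul c F _ h => simpa using isBigO_one_mul (isBigO_const_const c one_ne_zero _) h

lemma mode_zero_negSucc (n : ℕ) (f : Bra) :
    mode 0 (Int.negSucc n) f = ((n : ℂ) + 1) • MvPolynomial.pderiv n.succPNat f := by
  simp [mode]

lemma exists_forall_lt_mode_eq_zero (f : Bra) : ∃ M : ℕ, ∀ n : ℤ, n < -(M : ℤ) → mode 0 n f = 0 := by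
  refine ⟨f.vars.sup fun k => (k : ℕ), fun n hn => ?_⟩
  match n with
  | Int.ofNat n => exact absurd hn (by simp)
  | Int.negSucc n =>
    rw [mode_zero_negSucc, MvPolynomial.pderiv_eq_zero_of_notMem_vars, smul_zero]
    intro h
    have := Finset.le_sup (f := fun k : ℕ+ => (k : ℕ)) h
    simp only [Nat.succPNat_coe] at this
    omega

/-- Finitely many polynomials involve finitely many variables, which gives a bound on the
contributing negative modes that is uniform in g. -/
lemma exists_forall_lt_mode_eq_zero_of_mem_polyFamily {F : ℝ → Bra} (hF : F ∈ polyFamily) :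
    ∃ M : ℕ, ∀ n : ℤ, n < -(M : ℤ) → ∀ g, mode 0 n (F g) = 0 := by
  induction hF using Submodule.span_induction with
  | mem F hF =>
    obtain ⟨⟨k, f⟩, rfl⟩ := hF
    obtain ⟨M, hM⟩ := exists_forall_lt_mode_eq_zero f
    exact ⟨M, fun n hn g => by simp [hM n hn]⟩
  | zero => exact ⟨0, by simp⟩
  | add F F' _ _ h h' =>
    obtain ⟨M, hM⟩ := h
    obtain ⟨M', hM'⟩ := h'
    refine ⟨max M M', fun n hn g => ?_⟩
    rw [Pi.add_apply, map_add, hM n (by omega), hM' n (by omega), add_zero]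
  | smul c F _ h =>
    obtain ⟨M, hM⟩ := h
    exact ⟨M, fun n hn g => by simp [hM n hn]⟩

/-- The first-order symbol of `g αₙ` at the bra `f`: its value and its fluctuation. -/
def symbol (b : ℕ+ → ℂ) (v : (ℕ+ →₀ ℕ) → ℕ → ℂ) (f : Bra) (n : ℤ) : TrivSqZeroExt ℂ Bra :=
  TrivSqZeroExt.inl (modeValue b v n) + TrivSqZeroExt.inr (mode 0 n f)

@[simp] lemma fst_symbol (b : ℕ+ → ℂ) (v : (ℕ+ →₀ ℕ) → ℕ → ℂ) (f : Bra) (n : ℤ) :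
    (symbol b v f n).fst = modeValue b v n := by simp [symbol]

@[simp] lemma snd_symbol (b : ℕ+ → ℂ) (v : (ℕ+ →₀ ℕ) → ℕ → ℂ) (f : Bra) (n : ℤ) :
    (symbol b v f n).snd = mode 0 n f := by simp [symbol]

lemma fst_prod_symbol (b : ℕ+ → ℂ) (v : (ℕ+ →₀ ℕ) → ℕ → ℂ) (f : Bra) (l : List ℤ) :
    (l.map (symbol b v f)).prod.fst = (l.map (modeValue b v)).prod := by
  rw [TrivSqZeroExt.fst_list_prod, List.map_map]
  congr 2
  funext n
  simp

lemma prod_symbol_cons_snd (b : ℕ+ → ℂ) (v : (ℕ+ →₀ ℕ) → ℕ → ℂ) (f : Bra) (n : ℤ) (l : List ℤ) :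
    ((n :: l).map (symbol b v f)).prod.snd = modeValue b v n • (l.map (symbol b v f)).prod.snd +
      (l.map (modeValue b v)).prod • mode 0 n f := by
  simp [TrivSqZeroExt.snd_mul, fst_prod_symbol]

lemma prod_symbol_snd_mem_polyFamily (b : ℕ+ → ℂ) (v : (ℕ+ →₀ ℕ) → ℕ → ℂ) {F : ℝ → Bra}
    (hF : F ∈ polyFamily) (l : List ℤ) :
    (fun g => (l.map (symbol b v (F g))).prod.snd) ∈ polyFamily := by
  induction l with
  | nil =>
    simp only [List.map_nil, List.prod_nil, TrivSqZeroExt.snd_one]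
    exact polyFamily.zero_mem
  | cons n l ih =>
    simp only [prod_symbol_cons_snd]
    exact polyFamily.add_mem (polyFamily.smul_mem _ ih)
      (polyFamily.smul_mem _ (map_mem_polyFamily (mode 0 n) hF))

/-- Expansion of a product of shifted modes to first order. -/
lemma exists_prod_shifted_modes (b : ℕ+ → ℂ) (v : (ℕ+ →₀ ℕ) → ℕ → ℂ) {F : ℝ → Bra}
    (hF : F ∈ polyFamily) (l : List ℤ) :
    ∃ R ∈ polyFamily, ∀ g : ℝ,
      (l.map fun n => modeValue b v n • (1 : Module.End ℂ Bra) + (g : ℂ) • mode 0 n).prod (F g) =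
        (l.map (modeValue b v)).prod • F g + (g : ℂ) • (l.map (symbol b v (F g))).prod.snd +
          (g : ℂ) ^ 2 • R g := by
  induction l with
  | nil => exact ⟨0, polyFamily.zero_mem, by simp⟩
  | cons n l ih =>
    obtain ⟨R, hR, h⟩ := ih
    -- The new factor acts last. Order g² and beyond collects its value on the old remainder, its
    -- fluctuation on the first-order term, and g times its fluctuation on the old remainder.
    refine ⟨fun g => modeValue b v n • R g + mode 0 n (l.map (symbol b v (F g))).prod.snd +
      (g : ℂ) • mode 0 n (R g), ?_, fun g => ?_⟩
    · exact polyFamily.add_mem (polyFamily.add_mem (polyFamily.smul_mem _ hR)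
        (map_mem_polyFamily _ (prod_symbol_snd_mem_polyFamily b v hF l)))
        (coupling_smul_mem_polyFamily (map_mem_polyFamily _ hR))
    · rw [List.map_cons, List.prod_cons, Module.End.mul_apply, h g, prod_symbol_cons_snd]
      simp only [LinearMap.add_apply, LinearMap.smul_apply, Module.End.one_apply, map_add, map_smul,
        List.map_cons, List.prod_cons]
      module

lemma prod_modes_shift (b : ℕ+ → ℂ) (v : (ℕ+ →₀ ℕ) → ℕ → ℂ) {g : ℝ} (hg : g ≠ 0) (l : List ℤ)
    (f : Bra) :
    (l.map (mode (background b g))).prod (shift (onePoint v g) f) =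
      ((g : ℂ)⁻¹) ^ l.length • shift (onePoint v g)
        ((l.map fun n => modeValue b v n • (1 : Module.End ℂ Bra) + (g : ℂ) • mode 0 n).prod f) := by
  induction l with
  | nil => simp
  | cons n l ih =>
    rw [List.map_cons, List.prod_cons, Module.End.mul_apply, ih, map_smul, mode_shift b v hg,
      smul_smul, List.map_cons, List.prod_cons, Module.End.mul_apply, List.length_cons, pow_succ]

/-- Expansion of an oscillator-normal-ordered product of modes to first order. -/
lemma exists_modes_shift (b : ℕ+ → ℂ) (v : (ℕ+ →₀ ℕ) → ℕ → ℂ) {F : ℝ → Bra}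
    (hF : F ∈ polyFamily) (l : List ℤ) :
    ∃ R ∈ polyFamily, ∀ g : ℝ, g ≠ 0 →
      (g : ℂ) ^ l.length • modes (background b g) l (shift (onePoint v g) (F g)) =
        shift (onePoint v g) ((l.map (modeValue b v)).prod • F g +
          (g : ℂ) • (l.map (symbol b v (F g))).prod.snd + (g : ℂ) ^ 2 • R g) := by
  set l' := l.filter (fun n => 0 ≤ n) ++ l.filter (fun n => n < 0) with hl'
  have hperm : l'.Perm l := by
    have := List.filter_append_perm (fun n : ℤ => decide (0 ≤ n)) l
    rwa [show (fun n : ℤ => !decide (0 ≤ n)) = fun n => decide (n < 0) by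
      funext n; rw [← decide_not]; simp] at this
  obtain ⟨R, hR, h⟩ := exists_prod_shifted_modes b v hF l'
  refine ⟨R, hR, fun g hg => ?_⟩
  have hg' : (g : ℂ) ≠ 0 := by exact_mod_cast hg
  have h1 : modes (background b g) l = (l'.map (mode (background b g))).prod := by
    rw [hl', List.map_append, List.prod_append]; rfl
  -- The values and the symbols multiply commutatively, so to first order the normal ordering is
  -- invisible; a different order changes only `R`.
  rw [h1, prod_modes_shift b v hg, smul_smul, h g, hperm.length_eq, ← mul_pow,
    mul_inv_cancel₀ hg', one_pow, one_smul, (hperm.map (modeValue b v)).prod_eq,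
    (hperm.map (symbol b v (F g))).prod_eq]

/-! ### Products of Laurent series -/

lemma laurent_eq_single_mul {R : Type*} [CommRing R] {M : ℕ} {f : LaurentSeries R}
    (hf : ∀ n : ℤ, n < -(M : ℤ) → f.coeff n = 0) :
    f = HahnSeries.single (-(M : ℤ)) (1 : R) *
      HahnSeries.ofPowerSeries ℤ R (PowerSeries.mk fun j => f.coeff ((j : ℤ) - M)) := by
  ext n
  rw [HahnSeries.coeff_single_mul, one_mul,
    PowerSeries.coeff_coe]
  split_ifs with h
  · exact hf _ (by omega)
  · rw [PowerSeries.coeff_mk]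
    congr 1
    omega

/-- A coefficient of a product of Laurent series, as a sum over a sufficiently large finite set of
tuples of exponents. -/
lemma laurent_coeff_prod {R : Type*} [CommRing R] {r : ℕ} (f : Fin r → LaurentSeries R) {M : ℕ}
    (hf : ∀ i, ∀ n : ℤ, n < -(M : ℤ) → (f i).coeff n = 0) (N : ℤ)
    (S : Finset {n : Fin r → ℤ // ∑ i, n i = N})
    (hS : ∀ n : {n : Fin r → ℤ // ∑ i, n i = N}, (∀ i, -(M : ℤ) ≤ n.1 i) → n ∈ S) :
    ∑ n ∈ S, ∏ i, (f i).coeff (n.1 i) = (∏ i, f i).coeff N := by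
  classical
  have hz : ∀ n : {n : Fin r → ℤ // ∑ i, n i = N}, (¬ ∀ i, -(M : ℤ) ≤ n.1 i) →
      ∏ i, (f i).coeff (n.1 i) = 0 := fun n hn => by
    push Not at hn
    obtain ⟨i, hi⟩ := hn
    exact Finset.prod_eq_zero (Finset.mem_univ i) (hf i _ hi)
  -- Shifting every exponent by M reduces to power series, whose product has coefficients given by
  -- finite antidiagonals.
  have hprod : ∏ i, f i = HahnSeries.single (-(r * M : ℤ)) (1 : R) *
      HahnSeries.ofPowerSeries ℤ R
        (∏ i, PowerSeries.mk fun j => (f i).coeff ((j : ℤ) - M)) := by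
    rw [map_prod, Finset.prod_congr rfl fun i _ => laurent_eq_single_mul (hf i),
      Finset.prod_mul_distrib]
    simp [HahnSeries.single_pow]
  rw [hprod, HahnSeries.coeff_single_mul, one_mul, PowerSeries.coeff_coe]
  split_ifs with hN
  -- Here N < -rM, so no tuple with all entries at least -M has sum N.
  · refine Finset.sum_eq_zero fun n _ => hz n fun h => ?_
    have := Finset.sum_le_sum fun i (_ : i ∈ Finset.univ) => h i
    rw [n.2] at this
    simp at this
    omega
  · rw [PowerSeries.coeff_prod, ← Finset.sum_filter_of_ne (p := fun n => ∀ i, -(M : ℤ) ≤ n.1 i)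
      fun n _ h => by_contra fun hn => h (hz n hn)]
    have hsum : ∀ l : Fin r →₀ ℕ, ∑ i, ((l i : ℤ) - M) = (∑ i, l i : ℕ) - r * M := fun l => by
      simp
    refine Finset.sum_bij' (fun n _ => Finsupp.equivFunOnFinite.symm fun i => (n.1 i + M).toNat)
      (fun l hl => ⟨fun i => (l i : ℤ) - M, ?_⟩) ?_ ?_ ?_ ?_ ?_
    · rw [Finset.mem_finsuppAntidiag] at hl
      have h1 : ∑ i, l i = _ := hl.1
      rw [hsum]
      omega
    · intro n hn
      rw [Finset.mem_filter] at hn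
      rw [Finset.mem_finsuppAntidiag]
      refine ⟨?_, by simp⟩
      zify
      rw [abs_of_nonneg (by omega)]
      have : ∀ i, ((Finsupp.equivFunOnFinite.symm fun i => (n.1 i + M).toNat) i : ℤ) =
          n.1 i + M := fun i => by
        have := hn.2 i
        simp
        omega
      rw [Finset.sum_congr rfl fun i _ => this i, Finset.sum_add_distrib, n.2]
      simp
    · intro l hl
      rw [Finset.mem_filter]
      refine ⟨hS _ fun i => ?_, fun i => ?_⟩ <;> simp
    · intro n hn
      rw [Finset.mem_filter] at hn
      ext i
      have := hn.2 i
      simp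
      omega
    · intro l hl
      ext i
      simp
    · intro n hn
      rw [Finset.mem_filter] at hn
      refine Finset.prod_congr rfl fun i _ => ?_
      have := hn.2 i
      rw [PowerSeries.coeff_mk]
      congr 1
      simp
      omega

end

section

/-! ### Expansion of the currents to first order in the fluctuations -/

lemma pderiv_comm (m n : ℕ+) (f : Bra) :
    MvPolynomial.pderiv m (MvPolynomial.pderiv n f) =
      MvPolynomial.pderiv n (MvPolynomial.pderiv m f) := by
  classical
  have : ⁅MvPolynomial.pderiv (R := ℂ) m, MvPolynomial.pderiv (R := ℂ) n⁆ = 0 := by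
    refine MvPolynomial.derivation_ext fun i => ?_
    rw [Derivation.commutator_apply, MvPolynomial.pderiv_X, MvPolynomial.pderiv_X,
      Pi.single_apply, Pi.single_apply]
    split_ifs <;> simp
  simpa [Derivation.commutator_apply, sub_eq_zero] using congrArg (fun D => D f) this

lemma mode_comm_of_neg (x : ℕ+ → ℂ) {m n : ℤ} (hm : m < 0) (hn : n < 0) (f : Bra) :
    mode x m (mode x n f) = mode x n (mode x m f) := by
  match m, n, hm, hn with
  | Int.negSucc m, Int.negSucc n, _, _ =>
    simp only [mode, LinearMap.smul_apply, LinearMap.add_apply, LinearMap.id_apply, map_add,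
      map_smul, Derivation.coeFn_coe, smul_add, smul_smul]
    rw [pderiv_comm]
    module

/-- Negative modes commute, so the one that annihilates the bra can be moved to act first. -/
lemma prod_modes_eq_zero {x : ℕ+ → ℂ} {l : List ℤ} (hl : ∀ n ∈ l, n < 0) {k : ℤ} (hk : k ∈ l)
    {f : Bra} (hf : mode x k f = 0) : (l.map (mode x)).prod f = 0 := by
  have comm : ∀ l : List ℤ, (∀ n ∈ l, n < 0) → k < 0 →
      mode x k ((l.map (mode x)).prod f) = (l.map (mode x)).prod (mode x k f) := by
    intro l
    induction l with
    | nil => simp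
    | cons n l ih =>
      intro h hk
      rw [List.map_cons, List.prod_cons, Module.End.mul_apply, Module.End.mul_apply,
        mode_comm_of_neg x hk (h n (by simp)), ih (fun m hm => h m (by simp [hm])) hk]
  induction l with
  | nil => simp at hk
  | cons n l ih =>
    rw [List.map_cons, List.prod_cons, Module.End.mul_apply]
    rcases List.mem_cons.mp hk with rfl | h
    · rw [comm l (fun m hm => hl m (by simp [hm])) (hl k hk), hf, map_zero]
    · rw [ih (fun m hm => hl m (by simp [hm])) h, map_zero]

/-- Normal ordering lets the negative modes act first, before a positive mode can introduce new
variables. This is what leaves finitely many tuples in `oscOrdered`. -/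
lemma modes_eq_zero {x : ℕ+ → ℂ} {l : List ℤ} {k : ℤ} (hk : k ∈ l) (hk0 : k < 0)
    {f : Bra} (hf : mode x k f = 0) : modes x l f = 0 := by
  rw [modes, Module.End.mul_apply,
    prod_modes_eq_zero (k := k) (fun n hn => by simpa using (List.mem_filter.mp hn).2)
      (List.mem_filter.mpr ⟨hk, by simpa using hk0⟩) hf, map_zero]

/-- The Laurent series with the given coefficients (`0` if these are not bounded below). -/
def laurentOf {R : Type*} [Zero R] (c : ℤ → R) : LaurentSeries R :=
  open Classical in
  if h : BddBelow (Function.support c) then HahnSeries.ofSuppBddBelow c h else 0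

lemma coeff_laurentOf {R : Type*} [Zero R] {c : ℤ → R} {M : ℕ}
    (h : ∀ n : ℤ, n < -(M : ℤ) → c n = 0) (n : ℤ) : (laurentOf c).coeff n = c n := by
  have : BddBelow (Function.support c) :=
    ⟨-(M : ℤ), fun n hn => by_contra fun hlt => hn (h n (not_le.mp hlt))⟩
  rw [laurentOf, dif_pos this]
  simp

/-- Genus-zero value of `g ∂ᵏφₐ`, as a series in `ζ^(-1/p)` up to a power of `ζ`. -/
def valueSeries (p : ℕ) (b : ℕ+ → ℂ) (v : (ℕ+ →₀ ℕ) → ℕ → ℂ) (a k : ℕ) : LaurentSeries ℂ :=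
  laurentOf fun n => fieldCoeff p a k n * modeValue b v n

/-- Value and fluctuation of `g ∂ᵏφₐ` at the bra `f`. -/
def symbolSeries (p : ℕ) (b : ℕ+ → ℂ) (v : (ℕ+ →₀ ℕ) → ℕ → ℂ) (a : ℕ) (f : Bra) (k : ℕ) :
    LaurentSeries (TrivSqZeroExt ℂ Bra) :=
  laurentOf fun n => fieldCoeff p a k n • symbol b v f n

/-- When the sum is fixed, lower bounds on the other entries bound each entry from above. -/
lemma finite_setOf_forall_ge {r : ℕ} (M : ℕ) (N : ℤ) :
    {n : {n : Fin r → ℤ // ∑ i, n i = N} | ∀ i, -(M : ℤ) ≤ n.1 i}.Finite := by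
  classical
  refine Set.Finite.of_finite_image (f := Subtype.val) ?_ Subtype.val_injective.injOn
  refine (Set.Finite.pi' (t := fun _ : Fin r => Set.Icc (-(M : ℤ)) (N + r * M))
    fun _ => Set.finite_Icc _ _).subset ?_
  rintro _ ⟨n, hn, rfl⟩ i
  refine ⟨hn i, ?_⟩
  have h1 : ∑ j ∈ Finset.univ.erase i, (-(M : ℤ)) ≤ ∑ j ∈ Finset.univ.erase i, n.1 j :=
    Finset.sum_le_sum fun j _ => hn j
  have h2 := Finset.add_sum_erase Finset.univ n.1 (Finset.mem_univ i)
  rw [n.2] at h2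
  have h3 : ((Finset.univ.erase i).card : ℤ) ≤ r := by
    exact_mod_cast (Finset.card_le_univ _).trans (by simp)
  rw [Finset.sum_const, nsmul_eq_mul] at h1
  nlinarith

/-- `A` has, on families of shifted bras, an expansion in which `d` is the genus-zero value of
`gʳ A` and `T` its first-order fluctuation, up to a scalar. -/
def HasExp (v : (ℕ+ →₀ ℕ) → ℕ → ℂ) (A : ℝ → Bra → Bra) (r : ℕ) (d : ℂ)
    (T : Bra → Bra) : Prop :=
  ∃ e : ℂ, ∀ F ∈ polyFamily, (fun g => T (F g)) ∈ polyFamily ∧ ∃ R ∈ polyFamily, ∀ g : ℝ, g ≠ 0 →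
    (g : ℂ) ^ r • A g (shift (onePoint v g) (F g)) =
      shift (onePoint v g) (d • F g + (g : ℂ) • (e • F g + T (F g)) + (g : ℂ) ^ 2 • R g)

variable {b : ℕ+ → ℂ} {v : (ℕ+ →₀ ℕ) → ℕ → ℂ}

lemma HasExp.add {A A' : ℝ → Bra → Bra} {r : ℕ} {d d' : ℂ} {T T' : Bra → Bra}
    (h : HasExp v A r d T) (h' : HasExp v A' r d' T') :
    HasExp v (fun g f => A g f + A' g f) r (d + d') (fun f => T f + T' f) := by
  obtain ⟨e, h⟩ := h
  obtain ⟨e', h'⟩ := h'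
  refine ⟨e + e', fun F hF => ?_⟩
  obtain ⟨hT, R, hR, H⟩ := h F hF
  obtain ⟨hT', R', hR', H'⟩ := h' F hF
  refine ⟨polyFamily.add_mem hT hT', R + R', polyFamily.add_mem hR hR', fun g hg => ?_⟩
  rw [smul_add, H g hg, H' g hg, ← map_add]
  congr 1
  rw [Pi.add_apply]
  module

lemma HasExp.zero (r : ℕ) : HasExp v (fun _ _ => 0) r 0 fun _ => 0 :=
  ⟨0, fun F _ => ⟨polyFamily.zero_mem, 0, polyFamily.zero_mem, fun g _ => by simp⟩⟩

lemma HasExp.smul {A : ℝ → Bra → Bra} {r : ℕ} {d : ℂ} {T : Bra → Bra}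
    (h : HasExp v A r d T) (c : ℂ) :
    HasExp v (fun g f => c • A g f) r (c * d) (fun f => c • T f) := by
  obtain ⟨e, h⟩ := h
  refine ⟨c * e, fun F hF => ?_⟩
  obtain ⟨hT, R, hR, H⟩ := h F hF
  refine ⟨polyFamily.smul_mem c hT, c • R, polyFamily.smul_mem c hR, fun g hg => ?_⟩
  rw [smul_comm, H g hg, ← map_smul]
  congr 1
  rw [Pi.smul_apply]
  module

lemma HasExp.sum {ι : Type*} (s : Finset ι) {A : ι → ℝ → Bra → Bra} {r : ℕ} {d : ι → ℂ}
    {T : ι → Bra → Bra} (h : ∀ i ∈ s, HasExp v (A i) r (d i) (T i)) :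
    HasExp v (fun g f => ∑ i ∈ s, A i g f) r (∑ i ∈ s, d i) (fun f => ∑ i ∈ s, T i f) := by
  classical
  induction s using Finset.induction_on with
  | empty => simpa using HasExp.zero r
  | insert i s hi ih =>
    simp only [Finset.sum_insert hi]
    exact (h i (by simp)).add (ih fun j hj => h j (by simp [hj]))

lemma HasExp.list_sum {ι : Type*} (l : List ι) {A : ι → ℝ → Bra → Bra} {r : ℕ}
    (h : ∀ i ∈ l, HasExp v (A i) r 0 fun _ => 0) :
    HasExp v (fun g f => (l.map fun i => A i g f).sum) r 0 fun _ => 0 := by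
  induction l with
  | nil => simpa using HasExp.zero r
  | cons i l ih =>
    simpa using (h i (by simp)).add (ih fun j hj => h j (by simp [hj]))

lemma coupling_pow_smul_mem_polyFamily {F : ℝ → Bra} (hF : F ∈ polyFamily) (k : ℕ) :
    (fun g : ℝ => (g : ℂ) ^ k • F g) ∈ polyFamily := by
  induction k with
  | zero => simpa using hF
  | succ k ih =>
    simpa only [pow_succ', smul_smul] using coupling_smul_mem_polyFamily ih

/-- Operators of lower order contribute only a scalar. -/
lemma HasExp.of_lt {A : ℝ → Bra → Bra} {r s : ℕ} {d : ℂ} {T : Bra → Bra}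
    (h : HasExp v A r d T) (hrs : r < s) : HasExp v A s 0 fun _ => 0 := by
  obtain ⟨e, h⟩ := h
  rcases Nat.lt_or_ge (r + 1) s with hs | hs
  -- At least two extra powers of g: the whole expansion goes into the second-order remainder.
  · refine ⟨0, fun F hF => ⟨polyFamily.zero_mem, ?_⟩⟩
    obtain ⟨hT, R, hR, H⟩ := h F hF
    refine ⟨fun g => (g : ℂ) ^ (s - r - 2) •
      (d • F g + (g : ℂ) • (e • F g + T (F g)) + (g : ℂ) ^ 2 • R g), ?_, fun g hg => ?_⟩
    · exact coupling_pow_smul_mem_polyFamily (polyFamily.add_mem (polyFamily.add_mem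
        (polyFamily.smul_mem d hF) (coupling_smul_mem_polyFamily
          (polyFamily.add_mem (polyFamily.smul_mem e hF) hT)))
        (coupling_pow_smul_mem_polyFamily hR 2)) _
    · have : s = (2 + (s - r - 2)) + r := by omega
      rw [this, pow_add, ← smul_smul, H g hg, ← map_smul]
      congr 1
      simp only [zero_smul, zero_add, smul_zero, smul_smul, add_zero]
      rw [pow_add]
      congr 3
      omega
  · obtain rfl : s = r + 1 := by omega
    -- Exactly one extra power of g: the classical value becomes the first-order scalar, and the
    -- fluctuation moves to second order.
    refine ⟨d, fun F hF => ⟨polyFamily.zero_mem, ?_⟩⟩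
    obtain ⟨hT, R, hR, H⟩ := h F hF
    refine ⟨fun g => (e • F g + T (F g)) + (g : ℂ) • R g, polyFamily.add_mem
      (polyFamily.add_mem (polyFamily.smul_mem e hF) hT) (coupling_smul_mem_polyFamily hR),
      fun g hg => ?_⟩
    rw [pow_succ', ← smul_smul, H g hg, ← map_smul]
    congr 1
    module

lemma modeValue_eq_zero {B : ℕ} (hb : ∀ n : ℕ+, B < (n : ℕ) → b n = 0) {n : ℤ}
    (hn : n < -(B : ℤ)) : modeValue b v n = 0 := by
  match n with
  | Int.ofNat n => exact absurd hn (by simp)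
  | Int.negSucc n =>
    have : b n.succPNat = 0 := hb _ (by simp only [Nat.succPNat_coe]; omega)
    simp [modeValue, this]

/-- On a polynomial family a single finite set of mode tuples suffices for all g. The first-order
expansion of each tuple is then summed, and the sums are recognised as coefficients of products of
Laurent series, over ℂ for the values and over the square-zero extension for the fluctuations. -/
theorem hasExp_oscOrdered (p : ℕ) {B : ℕ} (hb : ∀ n : ℕ+, B < (n : ℕ) → b n = 0) (a : ℕ)
    (ks : List ℕ) (N : ℤ) :
    HasExp v (fun g f => oscOrdered p (background b g) a ks N f) ks.length
      ((∏ i, valueSeries p b v a (ks.get i)).coeff N)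
      (fun f => ((∏ i, symbolSeries p b v a f (ks.get i)).coeff N).snd) := by
  refine ⟨0, fun F hF => ?_⟩
  obtain ⟨M₀, hM₀⟩ := exists_forall_lt_mode_eq_zero_of_mem_polyFamily hF
  -- Below -M both the classical values and the fluctuating modes vanish on the family, for every g.
  obtain ⟨M, hMB, hM⟩ : ∃ M : ℕ, B ≤ M ∧ ∀ n : ℤ, n < -(M : ℤ) → ∀ g, mode 0 n (F g) = 0 :=
    ⟨max B M₀, le_max_left _ _, fun n hn g => hM₀ n (by omega) g⟩
  have hq : ∀ n : ℤ, n < -(M : ℤ) → modeValue b v n = 0 := fun n hn =>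
    modeValue_eq_zero hb (by omega)
  have hsy : ∀ n : ℤ, n < -(M : ℤ) → ∀ g, symbol b v (F g) n = 0 := fun n hn g => by
    ext <;> simp [hq n hn, hM n hn g]
  set S := (finite_setOf_forall_ge (r := ks.length) M N).toFinset with hS
  have hmem : ∀ n : {n : Fin ks.length → ℤ // ∑ i, n i = N}, (∀ i, -(M : ℤ) ≤ n.1 i) → n ∈ S :=
    fun n hn => by simpa [hS] using hn
  have hd : ((∏ i, valueSeries p b v a (ks.get i)).coeff N) =
      ∑ n ∈ S, (∏ i, fieldCoeff p a (ks.get i) (n.1 i)) *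
        ((List.ofFn n.1).map (modeValue b v)).prod := by
    have hc : ∀ k, ∀ n : ℤ, n < -(M : ℤ) → fieldCoeff p a k n * modeValue b v n = 0 :=
      fun k n hn => by rw [hq n hn, mul_zero]
    rw [← laurent_coeff_prod (M := M) (fun i => valueSeries p b v a (ks.get i))
      (fun i n hn => by rw [valueSeries, coeff_laurentOf (hc _), hc _ n hn]) N S hmem]
    refine Finset.sum_congr rfl fun n _ => ?_
    rw [List.map_ofFn, List.prod_ofFn, ← Finset.prod_mul_distrib]
    exact Finset.prod_congr rfl fun i _ => coeff_laurentOf (hc _) _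
  have hT : ∀ g, ((∏ i, symbolSeries p b v a (F g) (ks.get i)).coeff N).snd =
      ∑ n ∈ S, (∏ i, fieldCoeff p a (ks.get i) (n.1 i)) •
        ((List.ofFn n.1).map (symbol b v (F g))).prod.snd := by
    intro g
    have hc : ∀ k, ∀ n : ℤ, n < -(M : ℤ) → fieldCoeff p a k n • symbol b v (F g) n = 0 :=
      fun k n hn => by rw [hsy n hn, smul_zero]
    rw [← laurent_coeff_prod (M := M) (fun i => symbolSeries p b v a (F g) (ks.get i))
      (fun i n hn => by rw [symbolSeries, coeff_laurentOf (hc _), hc _ n hn]) N S hmem,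
      TrivSqZeroExt.snd_sum]
    refine Finset.sum_congr rfl fun n _ => ?_
    rw [← TrivSqZeroExt.snd_smul, List.map_ofFn, List.prod_ofFn]
    simp only [Function.comp_apply]
    rw [← Finset.prod_smul]
    exact congrArg _ (Finset.prod_congr rfl fun i _ => coeff_laurentOf (hc _) _)
  have hosc : ∀ g : ℝ, g ≠ 0 → oscOrdered p (background b g) a ks N (shift (onePoint v g) (F g)) =
      ∑ n ∈ S, (∏ i, fieldCoeff p a (ks.get i) (n.1 i)) •
        modes (background b g) (List.ofFn n.1) (shift (onePoint v g) (F g)) := by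
    intro g hg
    rw [oscOrdered]
    refine finsum_eq_sum_of_support_subset _ fun n hn => ?_
    refine Finset.mem_coe.mpr (hmem n ?_)
    by_contra hlt
    push Not at hlt
    obtain ⟨i, hi⟩ := hlt
    refine hn ?_
    simp only
    rw [modes_eq_zero (k := n.1 i) (by simp [List.mem_ofFn]) (by omega), smul_zero]
    rw [mode_shift b v hg]
    simp [hq _ hi, hM _ hi g]
  choose R hR H using fun n : {n : Fin ks.length → ℤ // ∑ i, n i = N} =>
    exists_modes_shift b v hF (List.ofFn n.1)
  refine ⟨?_, fun g => ∑ n ∈ S, (∏ i, fieldCoeff p a (ks.get i) (n.1 i)) • R n g, ?_,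
    fun g hg => ?_⟩
  · have : (fun g => ((∏ i, symbolSeries p b v a (F g) (ks.get i)).coeff N).snd) =
        ∑ n ∈ S, (∏ i, fieldCoeff p a (ks.get i) (n.1 i)) •
        fun g => ((List.ofFn n.1).map (symbol b v (F g))).prod.snd := by
      funext g
      rw [hT g, Finset.sum_apply]
      rfl
    rw [this]
    exact polyFamily.sum_mem fun n _ => polyFamily.smul_mem _
      (prod_symbol_snd_mem_polyFamily b v hF _)
  · have : (fun g => ∑ n ∈ S, (∏ i, fieldCoeff p a (ks.get i) (n.1 i)) • R n g) =
        ∑ n ∈ S, (∏ i, fieldCoeff p a (ks.get i) (n.1 i)) • R n := by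
      funext g
      simp [Finset.sum_apply]
    rw [this]
    exact polyFamily.sum_mem fun n _ => polyFamily.smul_mem _ (hR n)
  · dsimp only
    rw [hosc g hg, Finset.smul_sum, hd, hT g, zero_smul, zero_add, Finset.sum_smul,
      Finset.smul_sum, Finset.smul_sum, ← Finset.sum_add_distrib, ← Finset.sum_add_distrib, map_sum]
    refine Finset.sum_congr rfl fun n _ => ?_
    have h := H n g hg
    rw [List.length_ofFn] at h
    rw [smul_comm, h, ← map_smul]
    congr 1
    module

/-! ### Leading parts of the Wick and Bell expansions -/

lemma length_le_of_mem_wick (p : ℕ) (ks : List ℕ) : ∀ t ∈ wick p ks, t.2.length ≤ ks.length := by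
  induction ks using wick.induct with
  | case1 => simp [wick]
  | case2 k ks ih ih' =>
    intro t ht
    rw [wick, List.mem_append, List.mem_map, List.mem_flatMap] at ht
    rcases ht with ⟨t, ht, rfl⟩ | ⟨j, -, ht'⟩
    · simpa using ih t ht
    · obtain ⟨t, ht, rfl⟩ := List.mem_map.mp ht'
      have h := ih' j _ ht
      rw [List.length_eraseIdx] at h
      simp only [List.length_cons]
      split at h <;> omega

/-- Every pairing removes two fields, so only the term without pairings keeps all of them. -/
lemma exists_wick_eq_cons (p : ℕ) (ks : List ℕ) :
    ∃ L, wick p ks = (1, ks) :: L ∧ ∀ t ∈ L, t.2.length < ks.length := by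
  induction ks with
  | nil => exact ⟨[], by simp [wick], by simp⟩
  | cons k ks ih =>
    obtain ⟨L, hL, h⟩ := ih
    refine ⟨_, by rw [wick, hL, List.map_cons, List.cons_append], fun t ht => ?_⟩
    rw [List.mem_append, List.mem_map, List.mem_flatMap] at ht
    rcases ht with ⟨t, ht, rfl⟩ | ⟨j, -, ht'⟩
    · simpa using h t ht
    · obtain ⟨t, ht, rfl⟩ := List.mem_map.mp ht'
      have h := length_le_of_mem_wick p _ t ht
      rw [List.length_eraseIdx] at h
      simp only [List.length_cons]
      split at h <;> omega

/-- Each step of the recursion either adds a factor ∂φ or differentiates an existing factor. Only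
the former raises the number of factors, so full length is reached in exactly one way. -/
lemma exists_bellMonomials_perm (s : ℕ) :
    ∃ L, (bellMonomials s).Perm (List.replicate s 1 :: L) ∧ ∀ ks ∈ L, ks.length < s := by
  induction s with
  | zero => exact ⟨[], by simp [bellMonomials], by simp⟩
  | succ s ih =>
    obtain ⟨L, hL, h⟩ := ih
    refine ⟨_, (by
      rw [bellMonomials]
      refine (hL.flatMap_right _).trans ?_
      rw [List.flatMap_cons, List.cons_append, ← List.replicate_succ]), fun ks hks => ?_⟩
    rw [List.mem_append, List.mem_map, List.mem_flatMap] at hks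
    rcases hks with ⟨j, -, rfl⟩ | ⟨ls, hls, hks⟩
    · simp
    · have := h ls hls
      rcases List.mem_cons.mp hks with rfl | hks
      · simpa using this
      · obtain ⟨j, -, rfl⟩ := List.mem_map.mp hks
        simp
        omega

lemma hasExp_wick (p : ℕ) {B : ℕ} (hb : ∀ n : ℕ+, B < (n : ℕ) → b n = 0) (a : ℕ) (N : ℤ) {s : ℕ}
    (L : List (ℂ × List ℕ)) (hL : ∀ t ∈ L, t.2.length < s) :
    HasExp v (fun g f => (L.map fun t => t.1 • oscOrdered p (background b g) a t.2 N f).sum)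
      s 0 fun _ => 0 :=
  HasExp.list_sum L fun t ht =>
    ((hasExp_oscOrdered p hb a t.2 N).smul t.1).of_lt (hL t ht)

lemma prod_replicate_one {R : Type*} [CommMonoid R] (f : ℕ → R) (s : ℕ) :
    ∏ i, f ((List.replicate s 1).get i) = f 1 ^ s := by
  simp

/-- The unpaired (∂φₐ)ˢ is the only term with s fields. Everything else has fewer and, by
`HasExp.of_lt`, contributes only to the unspecified scalar and to the remainder. -/
theorem hasExp_sheetCurrent (p : ℕ) {B : ℕ} (hb : ∀ n : ℕ+, B < (n : ℕ) → b n = 0) (a s : ℕ)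
    (m : ℤ) :
    HasExp v (fun g f => sheetCurrent p (background b g) a s m f) s
      ((valueSeries p b v a 1 ^ s).coeff (m - p * s))
      (fun f => ((symbolSeries p b v a f 1 ^ s).coeff (m - p * s)).snd) := by
  obtain ⟨L, hL, hlt⟩ := exists_bellMonomials_perm s
  obtain ⟨L', hL', hlt'⟩ := exists_wick_eq_cons p (List.replicate s 1)
  have h0 := hasExp_oscOrdered (v := v) p hb a (List.replicate s 1) (m - p * s)
  rw [prod_replicate_one (valueSeries p b v a),
    funext fun f => congrArg (fun S => TrivSqZeroExt.snd (HahnSeries.coeff S _))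
      (prod_replicate_one (symbolSeries p b v a f) s), List.length_replicate] at h0
  have h1 := hasExp_wick (v := v) p hb a (m - p * s) L' (s := s) (by simpa using hlt')
  have h2 : HasExp v (fun g f => (L.map fun ks =>
      ((wick p ks).map fun t => t.1 • oscOrdered p (background b g) a t.2 (m - p * s) f).sum).sum)
      s 0 fun _ => 0 :=
    HasExp.list_sum L fun ks hks => hasExp_wick p hb a _ _ fun t ht =>
      (length_le_of_mem_wick p ks t ht).trans_lt (hlt ks hks)
  have h3 := (h0.add h1).add h2
  simp only [add_zero] at h3
  convert h3 using 3 with g f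
  rw [sheetCurrent, (hL.map _).sum_eq, List.map_cons, List.sum_cons, hL', List.map_cons,
    List.sum_cons, one_smul]

end

section

/-! ### Fluctuations and connected correlators -/

/-- The fluctuation operator `∑_{k ≤ K} wₖ αₖ`. -/
def fluct (K : ℕ) (w : ℤ → ℂ) : Module.End ℂ Bra :=
  -- The polynomial bounds the contributing modes from below. Positive modes never annihilate a
  -- nonzero polynomial, so the upper bound has to come from the cutoff K.
  have hfin : ∀ f : Bra,
      (Function.support fun k : ℤ => (if k ≤ K then w k else 0) • mode 0 k f).Finite := fun f => by
    obtain ⟨M, hM⟩ := exists_forall_lt_mode_eq_zero f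
    refine (Set.finite_Icc (-(M : ℤ)) K).subset fun k hk => ?_
    by_contra h
    rw [Set.mem_Icc, not_and_or, not_le, not_le] at h
    refine hk ?_
    rcases h with h | h
    · simp [hM k h]
    · simp [not_le.mpr h]
  { toFun := fun f => ∑ᶠ k : ℤ, (if k ≤ K then w k else 0) • mode 0 k f
    map_add' := fun f f' => by
      simp only [map_add, smul_add]
      exact finsum_add_distrib (hfin f) (hfin f')
    map_smul' := fun c f => by
      simp only [map_smul, RingHom.id_apply]
      rw [smul_finsum]
      simp only [smul_comm c] }

lemma fluct_eq_sum (K : ℕ) (w : ℤ → ℂ) {M : ℕ} {f : Bra}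
    (hM : ∀ n : ℤ, n < -(M : ℤ) → mode 0 n f = 0) :
    fluct K w f = ∑ k ∈ Finset.Icc (-(M : ℤ)) K, w k • mode 0 k f := by
  have h : fluct K w f = ∑ᶠ k : ℤ, (if k ≤ K then w k else 0) • mode 0 k f := rfl
  rw [h, finsum_eq_sum_of_support_subset (s := Finset.Icc (-(M : ℤ)) K)]
  · refine Finset.sum_congr rfl fun k hk => ?_
    rw [if_pos (Finset.mem_Icc.mp hk).2]
  · intro k hk
    by_contra h
    rw [Finset.coe_Icc, Set.mem_Icc, not_and_or, not_le, not_le] at h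
    refine hk ?_
    rcases h with h | h
    · simp [hM k h]
    · simp [not_le.mpr h]

lemma laurent_coeff_mul {R : Type*} [CommRing R] (f f' : LaurentSeries R) (N : ℤ) (S : Finset ℤ)
    (hS : ∀ k, f.coeff (N - k) ≠ 0 → f'.coeff k ≠ 0 → k ∈ S) :
    (f * f').coeff N = ∑ k ∈ S, f.coeff (N - k) * f'.coeff k := by
  classical
  rw [HahnSeries.coeff_mul, ← Finset.sum_filter_of_ne (s := S)
    (p := fun k => f.coeff (N - k) ≠ 0 ∧ f'.coeff k ≠ 0)
    (fun k _ h => ⟨left_ne_zero_of_mul h, right_ne_zero_of_mul h⟩)]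
  refine Finset.sum_bij' (fun ij _ => ij.2) (fun k _ => (N - k, k)) ?_ ?_ ?_ ?_ ?_
  · rintro ⟨i, j⟩ h
    rw [Finset.mem_antidiagonal] at h
    obtain ⟨h1, h2, h3⟩ := h
    obtain rfl : i = N - j := by simp at h3; omega
    exact Finset.mem_filter.mpr ⟨hS j h1 h2, h1, h2⟩
  · intro k hk
    obtain ⟨-, h1, h2⟩ := Finset.mem_filter.mp hk
    exact Finset.mem_antidiagonal.mpr ⟨h1, h2, by simp⟩
  · rintro ⟨i, j⟩ h
    rw [Finset.mem_antidiagonal] at h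
    obtain ⟨h1, h2, h3⟩ := h
    simp at h3 ⊢
    omega
  · simp
  · rintro ⟨i, j⟩ h
    rw [Finset.mem_antidiagonal] at h
    obtain ⟨h1, h2, h3⟩ := h
    obtain rfl : i = N - j := by simp at h3; omega
    rfl

lemma add_pow_of_mul_self_eq_zero {R : Type*} [CommRing R] (x : R) {e : R} (he : e * e = 0)
    (s : ℕ) : (x + e) ^ s = x ^ s + s * (x ^ (s - 1) * e) := by
  induction s with
  | zero => simp
  | succ s ih =>
    rw [pow_succ, ih]
    rcases s with _ | s
    · simp
    · simp only [Nat.add_sub_cancel]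
      push_cast
      linear_combination ((s : R) + 1) * x ^ s * he

variable {b : ℕ+ → ℂ} {v : (ℕ+ →₀ ℕ) → ℕ → ℂ}

/-- The first-order fluctuation of the current, as a function of the mode number. -/
def sheetWeight (p : ℕ) (b : ℕ+ → ℂ) (v : (ℕ+ →₀ ℕ) → ℕ → ℂ) (a s : ℕ) (m k : ℤ) : ℂ :=
  s * (valueSeries p b v a 1 ^ (s - 1)).coeff (m - p * s - k) * fieldCoeff p a 1 k

/-- The symbol series is Q + E with E purely infinitesimal, so E² = 0 and (Q + E)ˢ = Qˢ + s Q^(s-1)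
E. The second component of a coefficient is therefore linear in the modes. -/
lemma snd_coeff_symbolSeries_pow (p : ℕ) {B : ℕ} (hb : ∀ n : ℕ+, B < (n : ℕ) → b n = 0)
    (a s : ℕ) (m : ℤ) {K : ℕ}
    (hK : ∀ k : ℤ, K < k → (valueSeries p b v a 1 ^ (s - 1)).coeff (m - p * s - k) = 0) (f : Bra) :
    ((symbolSeries p b v a f 1 ^ s).coeff (m - p * s)).snd = fluct K (sheetWeight p b v a s m) f := by
  obtain ⟨M₀, hM₀⟩ := exists_forall_lt_mode_eq_zero f
  obtain ⟨M, hMB, hM⟩ : ∃ M : ℕ, B ≤ M ∧ ∀ n : ℤ, n < -(M : ℤ) → mode 0 n f = 0 :=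
    ⟨max B M₀, le_max_left _ _, fun n hn => hM₀ n (by omega)⟩
  have hq : ∀ n : ℤ, n < -(M : ℤ) → modeValue b v n = 0 := fun n hn =>
    modeValue_eq_zero hb (by omega)
  set inlH : ℂ →+* TrivSqZeroExt ℂ Bra := TrivSqZeroExt.inlHom ℂ Bra with hinl
  set E : LaurentSeries (TrivSqZeroExt ℂ Bra) :=
    laurentOf fun n => TrivSqZeroExt.inr (fieldCoeff p a 1 n • mode 0 n f) with hE
  have hEc : ∀ n, E.coeff n = TrivSqZeroExt.inr (fieldCoeff p a 1 n • mode 0 n f) :=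
    coeff_laurentOf (M := M) fun n hn => by simp [hM n hn]
  set Q := valueSeries p b v a 1 with hQ
  have hQc : ∀ n, Q.coeff n = fieldCoeff p a 1 n * modeValue b v n :=
    coeff_laurentOf (M := M) fun n hn => by simp [hq n hn]
  have hsymb : symbolSeries p b v a f 1 = Q.map inlH + E := by
    ext1
    funext n
    rw [symbolSeries, coeff_laurentOf (M := M), HahnSeries.coeff_add, hEc,
      HahnSeries.map_coeff, hQc]
    · ext <;> simp [hinl]
    · intro n hn
      ext <;> simp [hM n hn, hq n hn]
  have hEE : E * E = 0 := by
    ext1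
    funext n
    rw [HahnSeries.coeff_mul]
    exact Finset.sum_eq_zero fun ij _ => by rw [hEc, hEc, TrivSqZeroExt.inr_mul_inr]
  have hpow : ∀ j : ℕ, (Q.map inlH) ^ j = (Q ^ j).map inlH := by
    intro j
    induction j with
    | zero =>
      ext1
      funext n
      rw [pow_zero, pow_zero, HahnSeries.map_coeff, HahnSeries.coeff_one, HahnSeries.coeff_one]
      split_ifs <;> simp
    | succ j ih =>
      rw [pow_succ, pow_succ, ih]
      exact (HahnSeries.map_mul (inlH : ℂ →ₙ+* TrivSqZeroExt ℂ Bra)).symm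
  have hexp : (Q.map inlH + E) ^ s = (Q ^ s).map inlH + s • ((Q ^ (s - 1)).map inlH * E) := by
    rw [← hpow, ← hpow, nsmul_eq_mul]
    exact add_pow_of_mul_self_eq_zero (R := LaurentSeries (TrivSqZeroExt ℂ Bra)) _ hEE s
  rw [hsymb, hexp, HahnSeries.coeff_add,
    TrivSqZeroExt.snd_add, HahnSeries.map_coeff, HahnSeries.coeff_nsmul,
    Pi.smul_apply, TrivSqZeroExt.snd_smul, laurent_coeff_mul _ _ _ (Finset.Icc (-(M : ℤ)) K),
    TrivSqZeroExt.snd_sum, fluct_eq_sum K _ hM, Finset.smul_sum]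
  · simp only [hinl, TrivSqZeroExt.inlHom_apply, TrivSqZeroExt.snd_inl, zero_add]
    refine Finset.sum_congr rfl fun k _ => ?_
    rw [HahnSeries.map_coeff, hEc, TrivSqZeroExt.inlHom_apply, TrivSqZeroExt.inl_mul_inr,
      TrivSqZeroExt.snd_inr, sheetWeight, ← Nat.cast_smul_eq_nsmul ℂ, smul_smul, smul_smul]
  · intro k h1 h2
    rw [Finset.mem_Icc]
    constructor
    · by_contra h
      exact h2 (by rw [hEc, hM k (by omega)]; simp)
    · by_contra h
      exact h1 (by rw [HahnSeries.map_coeff, hK k (by omega), map_zero])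

/-! ### Linearity of the currents -/

lemma exists_forall_lt_mode_eq_zero' {x : ℕ+ → ℂ} {B : ℕ} (hx : ∀ n : ℕ+, B < (n : ℕ) → x n = 0)
    (f : Bra) : ∃ M : ℕ, ∀ n : ℤ, n < -(M : ℤ) → mode x n f = 0 := by
  obtain ⟨M, hM⟩ := exists_forall_lt_mode_eq_zero f
  refine ⟨max M B, fun n hn => ?_⟩
  match n with
  | Int.ofNat n => exact absurd hn (by simp; omega)
  | Int.negSucc n =>
    have h1 : x n.succPNat = 0 := hx _ (by simp only [Nat.succPNat_coe]; omega)
    have h2 := hM (Int.negSucc n) (by omega)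
    rw [mode_zero_negSucc] at h2
    simpa [mode, h1] using h2

/-- A `finsum` is additive only on finite supports; this is where the finite support of the
background enters the linearity of the currents. -/
lemma oscOrdered_support_finite (p : ℕ) {x : ℕ+ → ℂ} {B : ℕ}
    (hx : ∀ n : ℕ+, B < (n : ℕ) → x n = 0) (a : ℕ) (ks : List ℕ) (N : ℤ) (f : Bra) :
    (Function.support fun n : {n : Fin ks.length → ℤ // ∑ i, n i = N} =>
      (∏ i, fieldCoeff p a (ks.get i) (n.1 i)) • modes x (List.ofFn n.1) f).Finite := by
  obtain ⟨M, hM⟩ := exists_forall_lt_mode_eq_zero' hx f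
  refine (finite_setOf_forall_ge M N).subset fun n hn => ?_
  rw [Set.mem_ofPred_eq]
  by_contra hlt
  push Not at hlt
  obtain ⟨i, hi⟩ := hlt
  refine hn ?_
  simp only
  rw [modes_eq_zero (k := n.1 i) (by simp [List.mem_ofFn]) (by omega) (hM _ hi), smul_zero]

lemma oscOrdered_add (p : ℕ) {x : ℕ+ → ℂ} {B : ℕ} (hx : ∀ n : ℕ+, B < (n : ℕ) → x n = 0) (a : ℕ)
    (ks : List ℕ) (N : ℤ) (f f' : Bra) : oscOrdered p x a ks N (f + f') =
      oscOrdered p x a ks N f + oscOrdered p x a ks N f' := by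
  simp only [oscOrdered, map_add, smul_add]
  exact finsum_add_distrib (oscOrdered_support_finite p hx a ks N f)
    (oscOrdered_support_finite p hx a ks N f')

lemma oscOrdered_smul (p : ℕ) (x : ℕ+ → ℂ) (a : ℕ) (ks : List ℕ) (N : ℤ) (c : ℂ) (f : Bra) :
    oscOrdered p x a ks N (c • f) = c • oscOrdered p x a ks N f := by
  simp only [oscOrdered, map_smul]
  rw [smul_finsum]
  simp only [smul_comm c]

lemma isLinearMap_sheetCurrent (p : ℕ) {x : ℕ+ → ℂ} {B : ℕ}
    (hx : ∀ n : ℕ+, B < (n : ℕ) → x n = 0) (a s : ℕ) (m : ℤ) :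
    IsLinearMap ℂ (sheetCurrent p x a s m) where
  map_add f f' := by
    simp only [sheetCurrent, oscOrdered_add p hx, smul_add, List.sum_map_add]
  map_smul c f := by
    simp only [sheetCurrent, oscOrdered_smul, smul_comm _ c, List.smul_sum, List.map_map,
      Function.comp_def]

/-! ### The connected two-point function -/

/-- The expectation value in terms of the fluctuating modes. -/
def shiftedExpect (Φ : ℝ → Bra →ₗ[ℂ] ℂ) (v : (ℕ+ →₀ ℕ) → ℕ → ℂ) (g : ℝ) : Bra →ₗ[ℂ] ℂ :=
  expectL (Φ g) ∘ₗ (shift (onePoint v g)).toLinearMap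

lemma shiftedExpect_apply (Φ : ℝ → Bra →ₗ[ℂ] ℂ) (v : (ℕ+ →₀ ℕ) → ℕ → ℂ) (g : ℝ) (f : Bra) :
    shiftedExpect Φ v g f = expect (Φ g) (shift (onePoint v g) f) := by
  simp [shiftedExpect, expectL_apply]

variable {Φ : ℝ → Bra →ₗ[ℂ] ℂ}

lemma shiftedExpect_one {g : ℝ} (h : Φ g 1 ≠ 0) : shiftedExpect Φ v g 1 = 1 := by
  rw [shiftedExpect_apply, map_one, expect_one h]

/-- The connected expectation value of two operators acting on the vacuum bra. -/
def connPair (Φ : ℝ → Bra →ₗ[ℂ] ℂ) (v : (ℕ+ →₀ ℕ) → ℕ → ℂ) (g : ℝ) (T T' : Module.End ℂ Bra) : ℂ :=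
  shiftedExpect Φ v g (T' (T 1)) - shiftedExpect Φ v g (T 1) * shiftedExpect Φ v g (T' 1)

lemma connPair_sum {ι κ : Type*} (g : ℝ) (s : Finset ι) (t : Finset κ)
    (T : ι → Module.End ℂ Bra) (T' : κ → Module.End ℂ Bra) :
    connPair Φ v g (∑ i ∈ s, T i) (∑ j ∈ t, T' j) =
      ∑ i ∈ s, ∑ j ∈ t, connPair Φ v g (T i) (T' j) := by
  simp only [connPair, LinearMap.sum_apply, map_sum, Finset.sum_sub_distrib, Finset.sum_mul_sum]

/-- Inserting the expansion of A and then that of A', all terms containing d, d', e or e' cancel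
against the product of the expectation values. The first survivor is the covariance of T and T' at
order g². -/
theorem connected_isBigO (hΦ : ∀ᶠ g in 𝓝[>] (0 : ℝ), Φ g 1 ≠ 0) (hv : HasGenusExpansion Φ v)
    {A A' : ℝ → Bra → Bra} {s t : ℕ} {d d' : ℂ} {T T' : Module.End ℂ Bra}
    (hA : HasExp v A s d T) (hA' : HasExp v A' t d' T') (hlin : ∀ g, IsLinearMap ℂ (A' g)) :
    (fun g : ℝ => (g : ℂ) ^ (s + t) *
        (expect (Φ g) (A' g (A g 1)) - expect (Φ g) (A g 1) * expect (Φ g) (A' g 1))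
      - (g : ℂ) ^ 2 * connPair Φ v g T T') =O[𝓝[>] 0] fun g : ℝ => g ^ 3 := by
  obtain ⟨e, hA⟩ := hA
  obtain ⟨e', hA'⟩ := hA'
  obtain ⟨-, R, hR, HR⟩ := hA _ (const_mem_polyFamily 1)
  obtain ⟨-, R', hR', HR'⟩ := hA' _ (const_mem_polyFamily 1)
  obtain ⟨-, R₁, hR₁, HR₁⟩ := hA' _ (const_mem_polyFamily (T 1))
  obtain ⟨-, R₂, hR₂, HR₂⟩ := hA' _ hR
  have hbd : ∀ {F : ℝ → Bra}, F ∈ polyFamily →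
      (fun g => shiftedExpect Φ v g (F g)) =O[𝓝[>] 0] fun _ => (1 : ℝ) := fun hF =>
    isBigO_one_of_mem_polyFamily (fun f => by
      simpa only [shiftedExpect_apply] using expect_shift_isBigO_one hΦ hv f) hF
  have hg1 : (fun g : ℝ => (g : ℂ)) =O[𝓝[>] 0] fun _ => (1 : ℝ) := by
    refine ((zpow_isBigO_one zero_le_one).norm_left.congr_left fun g => ?_).of_norm_left
    rw [zpow_one, Complex.norm_real]
  have hT := hbd (const_mem_polyFamily (T 1))
  have hT' := hbd (const_mem_polyFamily (T' 1))
  -- The bracket is what multiplies g³ once the cancellations are made. `R₁` and `R₂` are the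
  -- remainders of A' acting on T 1 and on the remainder of A.
  have hbracket : (fun g : ℝ =>
      -(shiftedExpect Φ v g (T 1) * shiftedExpect Φ v g (R' g))
      - shiftedExpect Φ v g (R g) * shiftedExpect Φ v g (T' 1)
      - (g : ℂ) * (shiftedExpect Φ v g (R g) * shiftedExpect Φ v g (R' g))
      + shiftedExpect Φ v g (R₁ g) + shiftedExpect Φ v g (T' (R g))
      + (g : ℂ) * shiftedExpect Φ v g (R₂ g)) =O[𝓝[>] 0] fun _ => (1 : ℝ) :=
    (((((isBigO_one_mul hT (hbd hR')).neg_left.sub (isBigO_one_mul (hbd hR) hT')).sub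
      (isBigO_one_mul hg1 (isBigO_one_mul (hbd hR) (hbd hR')))).add (hbd hR₁)).add
      (hbd (map_mem_polyFamily T' hR))).add (isBigO_one_mul hg1 (hbd hR₂))
  have hg3 : (fun g : ℝ => (g : ℂ) ^ 3) =O[𝓝[>] 0] fun g : ℝ => g ^ 3 :=
    (isBigO_refl (fun g : ℝ => g ^ 3) _).norm_left.congr_left (fun g => by
      rw [norm_pow, norm_pow, Complex.norm_real]) |>.of_norm_left
  have := hg3.mul hbracket
  simp only [mul_one] at this
  refine this.congr' ?_ .rfl
  filter_upwards [hΦ, self_mem_nhdsWithin] with g hg hpos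
  have hg0 : g ≠ 0 := ne_of_gt hpos
  have hΨ1 := shiftedExpect_one (v := v) hg
  have HA := congrArg (expectL (Φ g)) (HR g hg0)
  have HA' := congrArg (expectL (Φ g)) (HR' g hg0)
  have HA₁ := congrArg (expectL (Φ g)) (HR₁ g hg0)
  have HA₂ := congrArg (expectL (Φ g)) (HR₂ g hg0)
  have HAA : (g : ℂ) ^ (s + t) • A' g (A g 1) =
      (d + g * e) • (g : ℂ) ^ t • A' g (shift (onePoint v g) 1) +
      (g : ℂ) • (g : ℂ) ^ t • A' g (shift (onePoint v g) (T 1)) +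
      (g : ℂ) ^ 2 • (g : ℂ) ^ t • A' g (shift (onePoint v g) (R g)) := by
    have h1 := HR g hg0
    rw [map_one] at h1
    have h2 : (g : ℂ) ^ (s + t) • A' g (A g 1) = (g : ℂ) ^ t • A' g ((g : ℂ) ^ s • A g 1) := by
      rw [(hlin g).map_smul, smul_smul, pow_add, mul_comm]
    rw [h2, h1]
    simp only [map_add, map_smul, (hlin g).map_add, (hlin g).map_smul]
    module
  have HB := congrArg (expectL (Φ g)) HAA
  have hconv : ∀ f, expectL (Φ g) (shift (onePoint v g) f) = shiftedExpect Φ v g f := fun f => rfl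
  simp only [map_one] at HA HA' HAA HB
  simp only [hconv, map_add, map_smul, smul_eq_mul, hΨ1, mul_one] at HA HA' HA₁ HA₂ HB
  rw [HA', HA₁, HA₂] at HB
  simp only [expectL_apply] at HA HA' HB
  have hfac : (g : ℂ) ^ (s + t) * (expect (Φ g) (A g 1) * expect (Φ g) (A' g 1)) =
      ((g : ℂ) ^ s * expect (Φ g) (A g 1)) * ((g : ℂ) ^ t * expect (Φ g) (A' g 1)) := by
    rw [pow_add]; ring
  rw [mul_sub, HB, hfac, HA, HA', connPair]
  ring

/-- The genus-zero connected two-point function of the modes `αₖ`, `αₗ`, in this order. -/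
def pairValue (v : (ℕ+ →₀ ℕ) → ℕ → ℂ) : ℤ → ℤ → ℂ
  | Int.ofNat (k + 1), Int.ofNat (l + 1) =>
      v (Finsupp.single k.succPNat 1 + Finsupp.single l.succPNat 1) 0
  | Int.ofNat (k + 1), Int.negSucc l => if k = l then (k : ℂ) + 1 else 0
  | _, _ => 0

lemma mode_one_of_nonpos {k : ℤ} (hk : k ≤ 0) : mode 0 k 1 = 0 := by
  match k with
  | Int.ofNat 0 => simp [mode]
  | Int.ofNat (k + 1) => simp at hk; omega
  | Int.negSucc k => rw [mode_zero_negSucc, MvPolynomial.pderiv_one, smul_zero]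

lemma mode_natCast_succ (x : ℕ+ → ℂ) (k : ℕ) (f : Bra) :
    mode x (Int.ofNat (k + 1)) f = MvPolynomial.X k.succPNat * f := rfl

/-- For two positive modes the translation drops out of the covariance, which is then the cumulant.
For a positive mode followed by a negative one, the derivative of the variable gives the commutator
exactly. In the other cases the first mode kills the unit bra or one of the modes is α₀ = 0. -/
lemma connPair_mode_isBigO (hΦ : ∀ᶠ g in 𝓝[>] (0 : ℝ), Φ g 1 ≠ 0) (hv : HasGenusExpansion Φ v)
    (k l : ℤ) :
    (fun g : ℝ => connPair Φ v g (mode 0 k) (mode 0 l) - pairValue v k l) =O[𝓝[>] 0]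
      fun g : ℝ => g := by
  have hzero : ∀ {u : ℝ → ℂ}, (∀ᶠ g in 𝓝[>] (0 : ℝ), u g = 0) →
      u =O[𝓝[>] 0] fun g : ℝ => g := fun h =>
    (isBigO_zero _ _).congr' (h.mono fun g hg => hg.symm) .rfl
  match k, l with
  | Int.ofNat (k + 1), Int.ofNat (l + 1) =>
    refine (hv.connected_pair k.succPNat l.succPNat).congr' ?_ .rfl
    filter_upwards [hΦ] with g hg
    rw [connected_pair_eq hg, connPair]
    simp only [mode_natCast_succ, mul_one, shiftedExpect_apply, map_mul, shift_X, pairValue]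
    simp only [← expectL_apply, mul_sub, sub_mul, map_sub]
    have h1 : expectL (Φ g) 1 = 1 := by rw [expectL_apply, expect_one hg]
    have hC : ∀ c : ℂ, expectL (Φ g) (MvPolynomial.C c) = c := fun c => by
      rw [← mul_one (MvPolynomial.C c), ← MvPolynomial.smul_eq_C_mul, map_smul, h1, smul_eq_mul,
        mul_one]
    have hCX : ∀ (c : ℂ) (f : Bra), expectL (Φ g) (MvPolynomial.C c * f) = c * expectL (Φ g) f :=
      fun c f => by rw [← MvPolynomial.smul_eq_C_mul, map_smul, smul_eq_mul]
    rw [mul_comm (MvPolynomial.X l.succPNat) (MvPolynomial.C _), hCX, hCX, hCX, hC, hC,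
      mul_comm (MvPolynomial.X l.succPNat)]
    ring
  | Int.ofNat (k + 1), Int.ofNat 0 =>
    refine hzero (Eventually.of_forall fun g => ?_)
    simp [connPair, pairValue, mode]
  | Int.ofNat (k + 1), Int.negSucc l =>
    refine hzero ?_
    filter_upwards [hΦ] with g hg
    have h1 := shiftedExpect_one (v := v) hg
    rw [connPair, mode_one_of_nonpos (Int.negSucc_lt_zero l).le, map_zero, mul_zero, sub_zero,
      mode_natCast_succ, mul_one, mode_zero_negSucc]
    simp only [pairValue]
    split_ifs with hkl
    · subst hkl
      rw [MvPolynomial.pderiv_X_self, map_smul, h1]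
      simp
    · rw [MvPolynomial.pderiv_X_of_ne (fun h => hkl (Nat.succPNat_injective h))]
      simp
  | Int.ofNat 0, l =>
    refine hzero (Eventually.of_forall fun g => ?_)
    simp [connPair, pairValue, mode]
  | Int.negSucc k, l =>
    refine hzero (Eventually.of_forall fun g => ?_)
    rw [connPair, mode_one_of_nonpos (Int.negSucc_lt_zero k).le]
    simp [pairValue]

lemma mode_mode_one_eq_zero {k l : ℤ} (K : ℕ) (hk : k ≤ K) (hl : l < -(K : ℤ)) :
    mode 0 l (mode 0 k 1) = 0 := by
  match k, l with
  | Int.ofNat 0, l => simp [mode]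
  | Int.negSucc k, l => rw [mode_one_of_nonpos (Int.negSucc_lt_zero k).le, map_zero]
  | Int.ofNat (k + 1), Int.ofNat l => exact absurd hl (by simp)
  | Int.ofNat (k + 1), Int.negSucc l =>
    rw [mode_natCast_succ, mul_one, mode_zero_negSucc, MvPolynomial.pderiv_X_of_ne, smul_zero]
    intro h
    have := Nat.succPNat_injective h
    simp at hk
    omega

/-- The first fluctuation acts on the unit bra, so its negative modes drop out. It creates only
variables of index at most K, so the second contributes no modes below -K, and the sum over pairs of
modes is finite. -/
theorem connPair_fluct_isBigO (hΦ : ∀ᶠ g in 𝓝[>] (0 : ℝ), Φ g 1 ≠ 0) (hv : HasGenusExpansion Φ v)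
    (K K' : ℕ) (w w' : ℤ → ℂ) :
    (fun g : ℝ => connPair Φ v g (fluct K w) (fluct K' w')
      - ∑ k ∈ Finset.Icc (-(0 : ℕ) : ℤ) K, w k * ∑ l ∈ Finset.Icc (-(K : ℤ)) K',
          w' l * pairValue v k l) =O[𝓝[>] 0] fun g : ℝ => g := by
  have h1 : ∀ n : ℤ, n < -((0 : ℕ) : ℤ) → mode 0 n 1 = 0 := fun n hn =>
    mode_one_of_nonpos (by simpa using hn.le)
  have h1' : ∀ n : ℤ, n < -(K : ℤ) → mode 0 n 1 = 0 := fun n hn => mode_one_of_nonpos (by omega)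
  have key : ∀ g, connPair Φ v g (fluct K w) (fluct K' w') =
      ∑ k ∈ Finset.Icc (-(0 : ℕ) : ℤ) K, w k * ∑ l ∈ Finset.Icc (-(K : ℤ)) K',
          w' l * connPair Φ v g (mode 0 k) (mode 0 l) := by
    intro g
    have e1 : fluct K' w' (fluct K w 1) = ∑ k ∈ Finset.Icc (-(0 : ℕ) : ℤ) K,
        w k • ∑ l ∈ Finset.Icc (-(K : ℤ)) K', w' l • mode 0 l (mode 0 k 1) := by
      rw [fluct_eq_sum K w h1, map_sum]
      refine Finset.sum_congr rfl fun k hk => ?_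
      rw [map_smul, fluct_eq_sum K' w' (M := K) fun n hn =>
        mode_mode_one_eq_zero K (Finset.mem_Icc.mp hk).2 hn]
    rw [connPair, e1, fluct_eq_sum K w h1, fluct_eq_sum K' w' h1']
    simp only [connPair, map_sum, map_smul, smul_eq_mul, mul_sub, Finset.sum_sub_distrib]
    congr 1
    rw [Finset.sum_mul]
    refine Finset.sum_congr rfl fun k _ => ?_
    rw [Finset.mul_sum, Finset.mul_sum]
    refine Finset.sum_congr rfl fun l _ => ?_
    ring
  simp only [key, ← Finset.sum_sub_distrib, ← mul_sub]
  exact IsBigO.fun_sum fun k _ => (IsBigO.fun_sum fun l _ =>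
    (connPair_mode_isBigO hΦ hv k l).const_mul_left _).const_mul_left _

end

section

/-! ### Expansion coefficients of the amplitudes -/

lemma fieldCoeff_one (p a : ℕ) (n : ℤ) :
    fieldCoeff p a 1 n = (p : ℂ)⁻¹ * omega p ^ (-n * (a : ℤ)) := by
  simp [fieldCoeff]

lemma omega_ne_zero (p : ℕ) : omega p ≠ 0 := Complex.exp_ne_zero _

lemma isPrimitiveRoot_omega {p : ℕ} (hp : 1 ≤ p) : IsPrimitiveRoot (omega p) p :=
  Complex.isPrimitiveRoot_exp p (by omega)

lemma coeff_valueSeries (p : ℕ) {b : ℕ+ → ℂ} {B : ℕ} (hb : ∀ n : ℕ+, B < (n : ℕ) → b n = 0)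
    (v : (ℕ+ →₀ ℕ) → ℕ → ℂ) (a k : ℕ) (n : ℤ) :
    (valueSeries p b v a k).coeff n = fieldCoeff p a k n * modeValue b v n :=
  coeff_laurentOf (M := B) (fun n hn => by rw [modeValue_eq_zero hb hn, mul_zero]) n

/-- The offset p accounts for the factor ζ⁻¹ in ∂φₐ. -/
lemma coeff_disk (p q : ℕ) {b : ℕ+ → ℂ} (hb : ∀ n : ℕ+, p + q < (n : ℕ) → b n = 0)
    (v : (ℕ+ →₀ ℕ) → ℕ → ℂ) (a : ℕ) (n : ℤ) :
    (disk p q b v a).coeff (p + n) = fieldCoeff p a 1 n * modeValue b v n := by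
  classical
  rw [disk, HahnSeries.coeff_add, HahnSeries.coeff_sum, HahnSeries.coeff_single_mul, one_mul,
    PowerSeries.coeff_coe, fieldCoeff_one]
  have hs : ∀ j : ℕ, (p : ℤ) + n = p - ((j : ℤ) + 1) ↔ n = Int.negSucc j := fun j => by
    rw [Int.negSucc_eq]; omega
  simp only [HahnSeries.coeff_single, hs]
  match n with
  | Int.ofNat 0 => simp [modeValue]
  | Int.ofNat (n + 1) =>
    rw [Finset.sum_eq_zero (fun j _ => if_neg fun h => by cases h), if_neg (by simp), zero_add, PowerSeries.coeff_mk]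
    have : ((p : ℤ) + Int.ofNat (n + 1) - (p + 1)).natAbs = n := by simp
    rw [this]
    simp only [modeValue]
    rw [mul_right_comm]
    simp
  | Int.negSucc n =>
    rw [if_pos (by rw [Int.negSucc_eq]; omega), add_zero]
    simp only [Int.negSucc.injEq, Finset.sum_ite_eq, Finset.mem_range, modeValue]
    have h1 : -Int.negSucc n * (a : ℤ) = ((n + 1) * a : ℕ) := by
      rw [Int.neg_negSucc]; push_cast; ring
    rw [h1, zpow_natCast]
    split_ifs with h
    · ring
    · rw [hb _ (by rw [Nat.succPNat_coe]; omega)]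
      ring

lemma disk_eq (p q : ℕ) {b : ℕ+ → ℂ} (hb : ∀ n : ℕ+, p + q < (n : ℕ) → b n = 0)
    (v : (ℕ+ →₀ ℕ) → ℕ → ℂ) (a : ℕ) :
    disk p q b v a = HahnSeries.single (p : ℤ) (1 : ℂ) * valueSeries p b v a 1 := by
  ext n
  rw [HahnSeries.coeff_single_mul, one_mul, coeff_valueSeries p hb, ← coeff_disk p q hb,
    add_sub_cancel]

/-- The s - 1 factors ζ⁻¹ shift the index by p (s - 1), turning m - p into m - p s. -/
lemma coeff_disk_pow (p q : ℕ) {b : ℕ+ → ℂ} (hb : ∀ n : ℕ+, p + q < (n : ℕ) → b n = 0)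
    (v : (ℕ+ →₀ ℕ) → ℕ → ℂ) (a : ℕ) {s : ℕ} (hs : 1 ≤ s) (m k : ℤ) :
    (disk p q b v a ^ (s - 1)).coeff (m - p - k) =
      (valueSeries p b v a 1 ^ (s - 1)).coeff (m - p * s - k) := by
  rw [disk_eq p q hb, mul_pow, HahnSeries.single_pow, one_pow, HahnSeries.coeff_single_mul, one_mul]
  congr 1
  obtain ⟨j, rfl⟩ : ∃ j, s = j + 1 := ⟨s - 1, by omega⟩
  simp only [Nat.add_sub_cancel, nsmul_eq_mul]
  push_cast
  ring

/-! ### Geometric expansion of the irregular term -/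

lemma geometric_mul_one_sub {K : Type*} [CommRing K] (z : K) :
    (PowerSeries.mk fun i => z ^ i) * (1 - PowerSeries.C z * PowerSeries.X) = 1 := by
  ext n
  rcases n with _ | n
  · simp
  · rw [mul_sub, mul_one, mul_comm (PowerSeries.C z), ← mul_assoc, map_sub, PowerSeries.coeff_mul_C,
      PowerSeries.coeff_succ_mul_X]
    simp [PowerSeries.coeff_one, pow_succ]

lemma geometric_sq {K : Type*} [CommRing K] (z : K) :
    (PowerSeries.mk fun i => z ^ i) ^ 2 = PowerSeries.mk fun i => ((i : K) + 1) * z ^ i := by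
  ext n
  rw [sq, PowerSeries.coeff_mul, PowerSeries.coeff_mk, Finset.sum_congr rfl (fun x hx => by
    rw [PowerSeries.coeff_mk, PowerSeries.coeff_mk, ← pow_add,
      Finset.HasAntidiagonal.mem_antidiagonal.mp hx])]
  simp

lemma outer'_single (n : ℤ) (c : ℂ) :
    outer' (HahnSeries.single n c) = HahnSeries.single n (HahnSeries.C c) := by
  ext1
  funext m
  rw [outer', HahnSeries.map_coeff, HahnSeries.coeff_single, HahnSeries.coeff_single]
  split_ifs <;> simp

lemma sq_mul_mul_mul {R : Type*} [CommRing R] (x y z w : R) :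
    (x * y) ^ 2 * (z * w) = (x ^ 2 * z) * (y ^ 2 * w) := by ring

/-- `(λ₁ - λ₂)⁻²` as a geometric series in the inner variable over the outer one. -/
lemma inv_sq_sub (x y : ℂ) (hx : x ≠ 0) :
    ((HahnSeries.single (-1 : ℤ) (HahnSeries.C x) - HahnSeries.C (HahnSeries.single (-1 : ℤ) y) :
      Series₂) ^ 2)⁻¹ = HahnSeries.single (2 : ℤ) (HahnSeries.C (x⁻¹ ^ 2)) *
        HahnSeries.ofPowerSeries ℤ (LaurentSeries ℂ)
          (PowerSeries.mk fun i => ((i : LaurentSeries ℂ) + 1) *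
            HahnSeries.single (-1 : ℤ) (x⁻¹ * y) ^ i) := by
  set z : LaurentSeries ℂ := HahnSeries.single (-1 : ℤ) (x⁻¹ * y) with hz
  have h1 : (HahnSeries.single (-1 : ℤ) (HahnSeries.C x) -
      HahnSeries.C (HahnSeries.single (-1 : ℤ) y) : Series₂) =
      HahnSeries.single (-1 : ℤ) (HahnSeries.C x) *
        HahnSeries.ofPowerSeries ℤ (LaurentSeries ℂ) (1 - PowerSeries.C z * PowerSeries.X) := by
    rw [map_sub, map_one, map_mul, HahnSeries.ofPowerSeries_C, HahnSeries.ofPowerSeries_X, mul_sub,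
      mul_one, hz]
    simp only [HahnSeries.C_apply, HahnSeries.single_mul_single]
    simp [hx]
  rw [← geometric_sq, h1]
  refine inv_eq_of_mul_eq_one_right ?_
  have h2 : HahnSeries.ofPowerSeries ℤ (LaurentSeries ℂ)
      (1 - PowerSeries.C z * PowerSeries.X) ^ 2 *
      HahnSeries.ofPowerSeries ℤ (LaurentSeries ℂ) ((PowerSeries.mk fun i => z ^ i) ^ 2) = 1 := by
    rw [← map_pow, ← map_mul, ← mul_pow, mul_comm (1 - _), geometric_mul_one_sub, one_pow, map_one]
  have h3 : HahnSeries.single (-1 : ℤ) (HahnSeries.C x : LaurentSeries ℂ) ^ 2 *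
      HahnSeries.single (2 : ℤ) (HahnSeries.C (x⁻¹ ^ 2)) = 1 := by
    rw [HahnSeries.single_pow, HahnSeries.single_mul_single, ← map_pow, ← map_mul, ← mul_pow,
      mul_inv_cancel₀ hx]
    simp
  exact (sq_mul_mul_mul (R := LaurentSeries (LaurentSeries ℂ)) _ _ _ _).trans
    ((congrArg₂ (· * ·) h3 h2).trans (one_mul (M := LaurentSeries (LaurentSeries ℂ)) _))

/-- The coefficients of the annulus amplitude with the irregular term, for `|ζ₁| > |ζ₂|`. -/
theorem coeff_ampA {p : ℕ} (v : (ℕ+ →₀ ℕ) → ℕ → ℂ) (a c : ℕ) (k l : ℤ) :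
    ((ampA p v Region.I a c).coeff (p + k)).coeff (p + l) =
      fieldCoeff p a 1 k * fieldCoeff p c 1 l * pairValue v k l := by
  have hω := omega_ne_zero p
  rw [ampA, annulus]
  -- The terms δ/(ζ₁ - ζ₂)² in the annulus amplitude and in A cancel, so only the regular part and
  -- the term in λ remain.
  refine (congrArg (fun F : Series₂ => (F.coeff (p + k)).coeff (p + l))
    (sub_add_cancel (G := Series₂) _ _)).trans ?_
  simp only [at₁, at₂, inner', double, dlamS, lamS, outer'_single]
  rw [inv_sq_sub _ _ (pow_ne_zero _ hω), HahnSeries.coeff_add, HahnSeries.coeff_add]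
  have e1 : ∀ (n : ℤ) (x y : LaurentSeries ℂ) (P : PowerSeries (LaurentSeries ℂ)) (m : ℤ),
      (HahnSeries.single n x * HahnSeries.C y * HahnSeries.ofPowerSeries ℤ (LaurentSeries ℂ) P).coeff
        m = x * y * if m - n < 0 then 0 else PowerSeries.coeff (m - n).natAbs P := by
    intro n x y P m
    rw [HahnSeries.C_apply, HahnSeries.single_mul_single, add_zero, HahnSeries.coeff_single_mul,
      PowerSeries.coeff_coe]
  have e2 : ∀ (n n' : ℤ) (x y x' : LaurentSeries ℂ) (P : PowerSeries (LaurentSeries ℂ)) (m : ℤ),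
      (HahnSeries.single n x * HahnSeries.C y * (HahnSeries.single n' x' *
        HahnSeries.ofPowerSeries ℤ (LaurentSeries ℂ) P)).coeff m =
        x * y * x' * if m - (n + n') < 0 then 0 else PowerSeries.coeff (m - (n + n')).natAbs P := by
    intro n n' x y x' P m
    rw [HahnSeries.C_apply, HahnSeries.single_mul_single, add_zero]
    refine (congrArg (fun F : Series₂ => F.coeff m) (mul_assoc (G := Series₂) _ _ _).symm).trans ?_
    rw [HahnSeries.single_mul_single, HahnSeries.coeff_single_mul, PowerSeries.coeff_coe]
  rw [e1, e2]
  have hnonpos : ∀ k : ℤ, k ≤ 0 → (p : ℤ) + k - (p + 1) < 0 ∧ (p : ℤ) + k - (p - 1 + 2) < 0 :=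
    fun k hk => ⟨by omega, by omega⟩
  match k, l with
  | Int.ofNat 0, l =>
    rw [if_pos (hnonpos _ (by simp)).1, if_pos (hnonpos _ (by simp)).2]
    simp [pairValue]
  | Int.negSucc k, l =>
    rw [if_pos (hnonpos _ (Int.negSucc_lt_zero k).le).1,
      if_pos (hnonpos _ (Int.negSucc_lt_zero k).le).2]
    simp [pairValue]
  | Int.ofNat (k + 1), l =>
    have h1 : (p : ℤ) + Int.ofNat (k + 1) - (p + 1) = k := by simp
    have h2 : (p : ℤ) + Int.ofNat (k + 1) - (p - 1 + 2) = k := by simp; omega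
    rw [h1, h2, if_neg (by simp), if_neg (by simp), Int.natAbs_natCast, PowerSeries.coeff_mk,
      PowerSeries.coeff_mk, HahnSeries.single_pow]
    -- The k-th term of the geometric series is a single monomial, pairing the mode k + 1 with the
    -- mode -(k + 1). Its weight k + 1 is the commutator.
    have h3 : (HahnSeries.C (omega p ^ a / p) * HahnSeries.single ((p : ℤ) - 1) (omega p ^ c / p) *
        HahnSeries.C ((omega p ^ a)⁻¹ ^ 2) * (((k : LaurentSeries ℂ) + 1) *
          HahnSeries.single (k • (-1 : ℤ)) (((omega p ^ a)⁻¹ * omega p ^ c) ^ k))) =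
        HahnSeries.single ((p : ℤ) + Int.negSucc k) (fieldCoeff p a 1 (Int.ofNat (k + 1)) *
          fieldCoeff p c 1 (Int.negSucc k) * ((k : ℂ) + 1)) := by
      have : ((k : LaurentSeries ℂ) + 1) = HahnSeries.single (0 : ℤ) ((k : ℂ) + 1) := by
        rw [← HahnSeries.C_apply, map_add, map_natCast, map_one]
      rw [this]
      simp only [HahnSeries.C_apply, HahnSeries.single_mul_single]
      have hexp : (0 : ℤ) + (p - 1) + 0 + (0 + k • (-1 : ℤ)) = p + Int.negSucc k := by
        rw [Int.negSucc_eq]; simp; ring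
      rw [hexp]
      congr 1
      rw [fieldCoeff_one, fieldCoeff_one]
      have ea : omega p ^ (-Int.ofNat (k + 1) * (a : ℤ)) = (omega p ^ a)⁻¹ ^ (k + 1) := by
        rw [mul_comm, zpow_mul, zpow_neg, ← inv_zpow, zpow_natCast]
        exact zpow_natCast _ _
      have ec : omega p ^ (-Int.negSucc k * (c : ℤ)) = (omega p ^ c) ^ (k + 1) := by
        rw [mul_comm, zpow_mul, Int.neg_negSucc, zpow_natCast, zpow_natCast]
      rw [ea, ec]
      have hx : omega p ^ a * (omega p ^ a)⁻¹ = 1 := mul_inv_cancel₀ (pow_ne_zero _ hω)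
      rw [mul_pow, pow_succ (omega p ^ a)⁻¹ k, pow_succ (omega p ^ c) k]
      linear_combination (p : ℂ)⁻¹ ^ 2 * ((k : ℂ) + 1) * (omega p ^ c) ^ k * omega p ^ c *
        (omega p ^ a)⁻¹ ^ k * (omega p ^ a)⁻¹ * hx
    rw [h3, map_one, one_mul, HahnSeries.coeff_single_mul, one_mul, PowerSeries.coeff_coe,
      HahnSeries.coeff_single]
    have hne : ∀ l : ℤ, (p : ℤ) + l = p + Int.negSucc k ↔ l = Int.negSucc k := fun l => by
      simp
    simp only [hne]
    match l with
    | Int.ofNat 0 => simp [pairValue]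
    | Int.negSucc l =>
      rw [if_pos (by rw [Int.negSucc_eq]; omega)]
      simp only [Int.negSucc.injEq, pairValue, zero_add, eq_comm (a := l)]
      split_ifs with hkl
      · subst hkl; rfl
      · simp
    | Int.ofNat (l + 1) =>
      have h4 : (p : ℤ) + Int.ofNat (l + 1) - (p + 1) = l := by simp
      rw [h4, if_neg (by simp), if_neg (fun h => by cases h), add_zero, Int.natAbs_natCast,
        PowerSeries.coeff_mk, fieldCoeff_one, fieldCoeff_one]
      simp only [pairValue]
      have h5 : -((k : ℤ) + 1) * a - (l + 1) * c =
          -Int.ofNat (k + 1) * a + -Int.ofNat (l + 1) * c := by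
        simp; ring
      rw [h5, zpow_add₀ hω]
      ring

end

section

/-! ### The leading term -/

lemma laurent_coeff_mul_shift {R : Type*} [CommRing R] (f f' : LaurentSeries R) (N q : ℤ)
    (S : Finset ℤ)
    (hS : ∀ k, f.coeff (N - q - k) ≠ 0 → f'.coeff (q + k) ≠ 0 → k ∈ S) :
    (f * f').coeff N = ∑ k ∈ S, f.coeff (N - q - k) * f'.coeff (q + k) := by
  rw [laurent_coeff_mul f f' N (S.map (addLeftEmbedding q)), Finset.sum_map]
  · simp [sub_sub]
  · intro k h1 h2
    refine Finset.mem_map.mpr ⟨k - q, hS _ ?_ ?_, by simp⟩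
    · convert h1 using 2; ring
    · convert h2 using 2; ring

lemma pairValue_of_nonpos (v : (ℕ+ →₀ ℕ) → ℕ → ℂ) {k : ℤ} (hk : k ≤ 0) (l : ℤ) :
    pairValue v k l = 0 := by
  match k, l with
  | Int.ofNat 0, l => simp [pairValue]
  | Int.ofNat (k + 1), l => simp at hk; omega
  | Int.negSucc k, l => simp [pairValue]

lemma pairValue_of_lt (v : (ℕ+ →₀ ℕ) → ℕ → ℂ) {k l : ℤ} (K : ℕ) (hk : k ≤ K) (hl : l < -(K : ℤ)) :
    pairValue v k l = 0 := by
  match k, l with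
  | Int.ofNat 0, l => simp [pairValue]
  | Int.negSucc k, l => simp [pairValue]
  | Int.ofNat (k + 1), Int.ofNat l => exact absurd hl (by simp)
  | Int.ofNat (k + 1), Int.negSucc l =>
    simp only [pairValue]
    rw [if_neg]
    rintro rfl
    simp at hk
    omega

/-- Multiplying out first in the outer and then in the inner variable reproduces the mode sum of
`connPair_fluct_isBigO` with the same cutoffs: powers of the disk amplitudes bound the modes from
above, the vanishing of `pairValue` from below. -/
theorem coeff_leadingTerm {p q : ℕ} {b : ℕ+ → ℂ} (hb : ∀ n : ℕ+, p + q < (n : ℕ) → b n = 0)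
    (v : (ℕ+ →₀ ℕ) → ℕ → ℂ) {s t : ℕ} (hs : 1 ≤ s) (ht : 1 ≤ t) (a c : ℕ) (m n : ℤ) {K K' : ℕ}
    (hK : ∀ k : ℤ, K < k → (valueSeries p b v a 1 ^ (s - 1)).coeff (m - p * s - k) = 0)
    (hK' : ∀ k : ℤ, K' < k → (valueSeries p b v c 1 ^ (t - 1)).coeff (n - p * t - k) = 0) :
    (s : ℂ) * t * coeff₂ Region.I (leadingTerm p q b v Region.I s t a c) m n =
      ∑ k ∈ Finset.Icc (-(0 : ℕ) : ℤ) K, sheetWeight p b v a s m k *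
        ∑ l ∈ Finset.Icc (-(K : ℤ)) K', sheetWeight p b v c t n l * pairValue v k l := by
  set x := disk p q b v a ^ (s - 1) with hx
  set y := disk p q b v c ^ (t - 1) with hy
  have hAz : ∀ k : ℤ, k ≤ 0 → (ampA p v Region.I a c).coeff (p + k) = 0 := fun k hk => by
    ext l
    rw [← add_sub_cancel (p : ℤ) l, coeff_ampA, pairValue_of_nonpos v hk, mul_zero]
    rfl
  have h1 : (outer' x * ampA p v Region.I a c).coeff m =
      ∑ k ∈ Finset.Icc (-(0 : ℕ) : ℤ) K, (outer' x).coeff (m - p - k) *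
        (ampA p v Region.I a c).coeff (p + k) := by
    refine laurent_coeff_mul_shift (R := LaurentSeries ℂ) (outer' x) (ampA p v Region.I a c) m p _
      fun k hk1 hk2 => ?_
    rw [Finset.mem_Icc]
    constructor
    · by_contra h
      exact hk2 (hAz k (by simp at h; omega))
    · by_contra h
      refine hk1 ?_
      rw [outer', HahnSeries.map_coeff, hx, coeff_disk_pow p q hb v a hs, hK k (by omega), map_zero]
  have h2 : (leadingTerm p q b v Region.I s t a c).coeff m =
      ∑ k ∈ Finset.Icc (-(0 : ℕ) : ℤ) K, x.coeff (m - p - k) •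
        (y * (ampA p v Region.I a c).coeff (p + k)) := by
    have : (leadingTerm p q b v Region.I s t a c).coeff m =
        (outer' x * ampA p v Region.I a c).coeff m * y := HahnSeries.coeff_mul_single_zero
    rw [this, h1, Finset.sum_mul]
    refine Finset.sum_congr rfl fun k _ => ?_
    rw [outer', HahnSeries.map_coeff, mul_assoc, HahnSeries.C_mul_eq_smul, mul_comm y]
  have h3 : ∀ k ∈ Finset.Icc (-(0 : ℕ) : ℤ) K,
      (y * (ampA p v Region.I a c).coeff (p + k)).coeff n =
      ∑ l ∈ Finset.Icc (-(K : ℤ)) K', y.coeff (n - p - l) *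
        (fieldCoeff p a 1 k * fieldCoeff p c 1 l * pairValue v k l) := by
    intro k hk
    rw [laurent_coeff_mul_shift y ((ampA p v Region.I a c).coeff (p + k)) n p
      (Finset.Icc (-(K : ℤ)) K')]
    · exact Finset.sum_congr rfl fun l _ => by rw [coeff_ampA]
    · intro l hl1 hl2
      rw [Finset.mem_Icc]
      constructor
      · by_contra h
        refine hl2 ?_
        rw [coeff_ampA, pairValue_of_lt v K (Finset.mem_Icc.mp hk).2 (by omega), mul_zero]
      · by_contra h
        refine hl1 ?_
        rw [hy, coeff_disk_pow p q hb v c ht, hK' l (by omega)]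
  rw [coeff₂, h2, HahnSeries.coeff_sum, Finset.mul_sum]
  refine Finset.sum_congr rfl fun k hk => ?_
  rw [HahnSeries.coeff_smul, smul_eq_mul, h3 k hk, Finset.mul_sum, Finset.mul_sum, Finset.mul_sum]
  refine Finset.sum_congr rfl fun l _ => ?_
  rw [hx, hy, coeff_disk_pow p q hb v a hs, coeff_disk_pow p q hb v c ht, sheetWeight, sheetWeight]
  ring

/-! ### Exchange of the two regions -/

lemma double_swap (c : ℕ → ℕ → ℂ) : double Region.II c = double Region.I fun i j => c j i := rfl

lemma sub_sq_comm_of_commRing {R : Type*} [CommRing R] (x y : R) : (x - y) ^ 2 = (y - x) ^ 2 := by ring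

lemma deltaTerm_swap (p a c : ℕ) : deltaTerm p Region.II a c = deltaTerm p Region.I c a := by
  unfold deltaTerm
  simp only [eq_comm (a := a)]
  split_ifs
  · exact congrArg (fun F : Series₂ => F⁻¹) (sub_sq_comm_of_commRing (R := Series₂) _ _)
  · rfl

/-- The cumulants are symmetric in their arguments and the irregular term is even in λ₁ - λ₂.
Exchanging the points therefore amounts to exchanging the sheets. -/
lemma annulus_swap (p : ℕ) (v : (ℕ+ →₀ ℕ) → ℕ → ℂ) (a c : ℕ) :
    annulus p v Region.II a c = annulus p v Region.I c a := by
  unfold annulus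
  rw [deltaTerm_swap, double_swap]
  have h : (fun i j : ℕ => ((p : ℂ) ^ 2)⁻¹ *
      v (Finsupp.single j.succPNat 1 + Finsupp.single i.succPNat 1) 0 *
      omega p ^ (-((j : ℤ) + 1) * (a : ℤ) - ((i : ℤ) + 1) * (c : ℤ))) =
      fun i j : ℕ => ((p : ℂ) ^ 2)⁻¹ *
      v (Finsupp.single i.succPNat 1 + Finsupp.single j.succPNat 1) 0 *
      omega p ^ (-((i : ℤ) + 1) * (c : ℤ) - ((j : ℤ) + 1) * (a : ℤ)) := by
    funext i j
    rw [add_comm (Finsupp.single j.succPNat 1)]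
    congr 2
    ring
  rw [h]
  exact congrArg₂ (fun x y : Series₂ => x + y - deltaTerm p Region.I c a)
    (congrArg (· * _) (mul_comm (G := Series₂) _ _))
    (congrArg₂ (fun x y : Series₂ => x * y⁻¹) (mul_comm (G := Series₂) _ _)
      (sub_sq_comm_of_commRing (R := Series₂) _ _))

lemma ampA_swap (p : ℕ) (v : (ℕ+ →₀ ℕ) → ℕ → ℂ) (a c : ℕ) :
    ampA p v Region.II a c = ampA p v Region.I c a := by
  rw [ampA, ampA, annulus_swap, deltaTerm_swap]

lemma mul_mul_comm_left {R : Type*} [CommRing R] (x y z : R) : x * y * z = z * y * x := by ring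

lemma leadingTerm_swap (p q : ℕ) (b : ℕ+ → ℂ) (v : (ℕ+ →₀ ℕ) → ℕ → ℂ) (s t a c : ℕ) :
    leadingTerm p q b v Region.II s t a c = leadingTerm p q b v Region.I t s c a := by
  rw [leadingTerm, leadingTerm, ampA_swap]
  exact mul_mul_comm_left (R := Series₂) _ _ _

/-! ### The cyclic symmetry -/

/-- The automorphism of Laurent series induced by `φ` on the coefficients and by `X ↦ uX`. -/
def twist {R : Type*} [CommRing R] (φ : R →+* R) (u : Rˣ) : LaurentSeries R →+* LaurentSeries R where
  toFun f :=
    { coeff := fun n => ((u ^ n : Rˣ) : R) * φ (f.coeff n)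
      isPWO_support' := f.isPWO_support.mono fun n hn h => hn (by simp [h]) }
  map_zero' := by ext1; funext n; simp
  map_one' := by
    ext1
    funext n
    simp only [HahnSeries.coeff_one]
    split_ifs with h <;> simp [h]
  map_add' f f' := by
    ext1
    funext n
    simp [mul_add]
  map_mul' f f' := by
    classical
    ext1
    funext n
    -- The twist creates no new nonzero coefficients, so the index set of the untwisted product
    -- serves for both sides.
    set S := (Finset.antidiagonal f.isPWO_support f'.isPWO_support n).image Prod.snd with hS
    have hmem : ∀ k, f.coeff (n - k) ≠ 0 → f'.coeff k ≠ 0 → k ∈ S := fun k h1 h2 =>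
      Finset.mem_image.mpr ⟨(n - k, k), Finset.mem_antidiagonal.mpr ⟨h1, h2, by simp⟩, rfl⟩
    rw [laurent_coeff_mul _ _ n S fun k h1 h2 => hmem k (fun h => h1 (by simp [h]))
      (fun h => h2 (by simp [h]))]
    dsimp only
    rw [laurent_coeff_mul f f' n S hmem, map_sum, Finset.mul_sum]
    refine Finset.sum_congr rfl fun k _ => ?_
    have : u ^ n = u ^ (n - k) * u ^ k := by rw [← zpow_add, sub_add_cancel]
    rw [map_mul, this, Units.val_mul]
    ring

lemma coeff_twist {R : Type*} [CommRing R] (φ : R →+* R) (u : Rˣ) (f : LaurentSeries R) (n : ℤ) :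
    (twist φ u f).coeff n = ((u ^ n : Rˣ) : R) * φ (f.coeff n) := rfl

/-- The rotation `u ↦ ω⁻ᵃ u` of series in one variable. -/
def rotate (p a : ℕ) : LaurentSeries ℂ →+* LaurentSeries ℂ :=
  twist (RingHom.id ℂ) (Units.mk0 (omega p) (omega_ne_zero p) ^ (-(a : ℤ)))

lemma coeff_rotate (p a : ℕ) (f : LaurentSeries ℂ) (n : ℤ) :
    (rotate p a f).coeff n = omega p ^ (-(a : ℤ) * n) * f.coeff n := by
  rw [rotate, coeff_twist, ← zpow_mul]
  simp

/-- The rotation of both variables, by `ω⁻ᵃ` in the outer and by `ω⁻ᶜ` in the inner one. -/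
def rotate₂ (p a c : ℕ) : LaurentSeries (LaurentSeries ℂ) →+* LaurentSeries (LaurentSeries ℂ) :=
  twist (rotate p c)
    (Units.map (HahnSeries.C : ℂ →+* LaurentSeries ℂ) (Units.mk0 (omega p) (omega_ne_zero p) ^ (-(a : ℤ))))

lemma coeff_rotate₂ (p a c : ℕ) (F : LaurentSeries (LaurentSeries ℂ)) (m : ℤ) :
    (rotate₂ p a c F).coeff m = omega p ^ (-(a : ℤ) * m) • rotate p c (F.coeff m) := by
  rw [rotate₂, coeff_twist, ← map_zpow, ← zpow_mul, ← HahnSeries.C_mul_eq_smul]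
  simp

lemma rotate₂_outer' (p a c : ℕ) (f : Series₁) :
    rotate₂ p a c (outer' f) = outer' (rotate p a f) := by
  ext1
  funext m
  rw [coeff_rotate₂, outer', outer', HahnSeries.map_coeff, HahnSeries.map_coeff, coeff_rotate,
    map_mul, HahnSeries.C_mul_eq_smul]
  congr 1
  ext n
  rw [coeff_rotate, HahnSeries.C_apply, HahnSeries.coeff_single]
  split_ifs with h <;> simp [h]

lemma rotate₂_inner' (p a c : ℕ) (f : Series₁) :
    rotate₂ p a c (inner' f) = inner' (rotate p c f) := by
  ext1
  funext m
  rw [coeff_rotate₂, inner', inner', HahnSeries.C_apply, HahnSeries.C_apply,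
    HahnSeries.coeff_single, HahnSeries.coeff_single]
  split_ifs with h <;> simp [h]

/-- Since ωᵖ = 1, the offset p does not change the phase. The sheet label thus enters as a rotation
by the full exponent p + n. -/
lemma fieldCoeff_rotate {p : ℕ} (hp : 1 ≤ p) (a : ℕ) (n : ℤ) :
    fieldCoeff p a 1 n = omega p ^ (-(a : ℤ) * (p + n)) * fieldCoeff p 0 1 n := by
  have h : omega p ^ (-(a : ℤ) * p) = 1 :=
    ((isPrimitiveRoot_omega hp).zpow_eq_one_iff_dvd _).mpr (Dvd.intro_left _ rfl)
  rw [fieldCoeff_one, fieldCoeff_one, mul_add, zpow_add₀ (omega_ne_zero p), h, one_mul]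
  rw [show -n * (a : ℤ) = -(a : ℤ) * n by ring]
  simp [mul_comm]

lemma rotate_disk {p q : ℕ} (hp : 1 ≤ p) {b : ℕ+ → ℂ}
    (hb : ∀ n : ℕ+, p + q < (n : ℕ) → b n = 0) (v : (ℕ+ →₀ ℕ) → ℕ → ℂ) (a : ℕ) :
    rotate p a (disk p q b v 0) = disk p q b v a := by
  ext n
  rw [coeff_rotate, ← add_sub_cancel (p : ℤ) n, coeff_disk p q hb, coeff_disk p q hb,
    fieldCoeff_rotate hp a, mul_assoc]

/-- The sheets enter the coefficients of A only through phases. The annulus amplitude itself lacks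
this covariance, because 1/(ζ₁ - ζ₂)² is rotation invariant but carries a δ in the sheets. -/
lemma rotate₂_ampA {p : ℕ} (hp : 1 ≤ p) (v : (ℕ+ →₀ ℕ) → ℕ → ℂ) (a c : ℕ) :
    rotate₂ p a c (ampA p v Region.I 0 0) = ampA p v Region.I a c := by
  ext1
  funext m
  ext n
  rw [coeff_rotate₂, HahnSeries.coeff_smul, coeff_rotate, ← add_sub_cancel (p : ℤ) n,
    ← add_sub_cancel (p : ℤ) m, coeff_ampA, coeff_ampA, fieldCoeff_rotate hp a,
    fieldCoeff_rotate hp c, smul_eq_mul]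
  ring

lemma rotate₂_leadingTerm {p q : ℕ} (hp : 1 ≤ p) {b : ℕ+ → ℂ}
    (hb : ∀ n : ℕ+, p + q < (n : ℕ) → b n = 0) (v : (ℕ+ →₀ ℕ) → ℕ → ℂ) (s t a c : ℕ) :
    rotate₂ p a c (leadingTerm p q b v Region.I s t 0 0) = leadingTerm p q b v Region.I s t a c := by
  have h1 : rotate₂ p a c (outer' (disk p q b v 0 ^ (s - 1))) =
      outer' (disk p q b v a ^ (s - 1)) := by
    rw [rotate₂_outer']
    exact congrArg outer' ((map_pow (rotate p a) (disk p q b v 0) (s - 1)).trans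
      (congrArg (· ^ (s - 1)) (rotate_disk hp hb v a)))
  have h2 : rotate₂ p a c (inner' (disk p q b v 0 ^ (t - 1))) =
      inner' (disk p q b v c ^ (t - 1)) := by
    rw [rotate₂_inner']
    exact congrArg inner' ((map_pow (rotate p c) (disk p q b v 0) (t - 1)).trans
      (congrArg (· ^ (t - 1)) (rotate_disk hp hb v c)))
  have h3 := rotate₂_ampA hp v a c
  exact ((rotate₂ p a c).map_mul _ _).trans (congrArg₂ (· * ·)
    (((rotate₂ p a c).map_mul _ _).trans (congrArg₂ (· * ·) h1 h3)) h2)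

/-- A geometric sum over the p-th roots of unity. -/
lemma sum_omega_zpow {p : ℕ} (hp : 1 ≤ p) (m : ℤ) :
    ∑ a ∈ Finset.range p, omega p ^ (-(a : ℤ) * m) = if (p : ℤ) ∣ m then (p : ℂ) else 0 := by
  have hz : ∀ a : ℕ, omega p ^ (-(a : ℤ) * m) = (omega p ^ (-m)) ^ a := fun a => by
    rw [← zpow_natCast, ← zpow_mul]
    congr 1
    ring
  simp only [hz]
  have hiff := (isPrimitiveRoot_omega hp).zpow_eq_one_iff_dvd (-m)
  rw [dvd_neg] at hiff
  split_ifs with h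
  · rw [hiff.mpr h]
    simp
  · have hne : omega p ^ (-m) ≠ 1 := fun h' => h (hiff.mp h')
    rw [geom_sum_eq hne, ← zpow_natCast, ← zpow_mul, mul_comm, zpow_mul, zpow_natCast,
      (isPrimitiveRoot_omega hp).pow_eq_one]
    simp

lemma natCast_sq_mul {R : Type*} [CommRing R] (p : ℕ) (x : R) : (p : R) ^ 2 * x = (p ^ 2) • x := by
  rw [nsmul_eq_mul, Nat.cast_pow]

/-- Rotations are ring homomorphisms, so every sheet term is a rotation of the one at (0, 0). In
each coefficient the two sheet sums factor into root-of-unity sums. -/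
theorem sum_leadingTerm_I {p q : ℕ} (hp : 1 ≤ p) {b : ℕ+ → ℂ}
    (hb : ∀ n : ℕ+, p + q < (n : ℕ) → b n = 0) (v : (ℕ+ →₀ ℕ) → ℕ → ℂ) (s t : ℕ) :
    ∑ a ∈ Finset.range p, ∑ c ∈ Finset.range p, leadingTerm p q b v Region.I s t a c =
      (p : Series₂) ^ 2 * intPart₂ p (leadingTerm p q b v Region.I s t 0 0) := by
  set L := leadingTerm p q b v Region.I s t 0 0 with hL
  have hp2 : (p : Series₂) ^ 2 * intPart₂ p L = (p ^ 2) • intPart₂ p L :=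
    natCast_sq_mul (R := Series₂) p _
  rw [hp2]
  ext1
  funext m
  ext n
  simp only [HahnSeries.coeff_sum, HahnSeries.coeff_nsmul, Pi.smul_apply]
  have hterm : ∀ a c, ((leadingTerm p q b v Region.I s t a c).coeff m).coeff n =
      omega p ^ (-(a : ℤ) * m) * omega p ^ (-(c : ℤ) * n) * (L.coeff m).coeff n := fun a c => by
    rw [← rotate₂_leadingTerm hp hb v s t a c, coeff_rotate₂, HahnSeries.coeff_smul, coeff_rotate,
      smul_eq_mul, mul_assoc]
  simp only [hterm, ← Finset.sum_mul, ← Finset.mul_sum, sum_omega_zpow hp]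
  simp only [intPart₂, intPart₁]
  by_cases h1 : (p : ℤ) ∣ m <;> by_cases h2 : (p : ℤ) ∣ n <;> simp [h1, h2, sq, mul_assoc]

theorem sum_leadingTerm {p q : ℕ} (hp : 1 ≤ p) {b : ℕ+ → ℂ}
    (hb : ∀ n : ℕ+, p + q < (n : ℕ) → b n = 0) (v : (ℕ+ →₀ ℕ) → ℕ → ℂ) (r : Region) (s t : ℕ) :
    ∑ a ∈ Finset.range p, ∑ c ∈ Finset.range p, leadingTerm p q b v r s t a c =
      (p : Series₂) ^ 2 * intPart₂ p (leadingTerm p q b v r s t 0 0) := by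
  cases r with
  | I => exact sum_leadingTerm_I hp hb v s t
  | II =>
    simp only [leadingTerm_swap]
    rw [Finset.sum_comm]
    exact sum_leadingTerm_I hp hb v t s

end

section

/-! ### The weak-coupling limit -/

lemma exists_hasExp_sheetCurrent (p : ℕ) {b : ℕ+ → ℂ} {B : ℕ}
    (hb : ∀ n : ℕ+, B < (n : ℕ) → b n = 0) (v : (ℕ+ →₀ ℕ) → ℕ → ℂ) (a s : ℕ) (m : ℤ) :
    ∃ K : ℕ, (∀ k : ℤ, K < k → (valueSeries p b v a 1 ^ (s - 1)).coeff (m - p * s - k) = 0) ∧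
      HasExp v (fun g f => sheetCurrent p (background b g) a s m f) s
        ((valueSeries p b v a 1 ^ s).coeff (m - p * s)) (fluct K (sheetWeight p b v a s m)) := by
  -- The cutoff is where the index m - p s - k falls below the order of the Laurent series.
  have hK : ∀ k : ℤ, ((m - p * s - (valueSeries p b v a 1 ^ (s - 1)).order).toNat : ℤ) < k →
      (valueSeries p b v a 1 ^ (s - 1)).coeff (m - p * s - k) = 0 := fun k hk =>
    HahnSeries.coeff_eq_zero_of_lt_order (by omega)
  refine ⟨_, hK, ?_⟩
  have h := hasExp_sheetCurrent (v := v) p hb a s m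
  rwa [funext fun f => snd_coeff_symbolSeries_pow p hb a s m hK f] at h

lemma background_eq_zero {b : ℕ+ → ℂ} {B : ℕ} (hb : ∀ n : ℕ+, B < (n : ℕ) → b n = 0) (g : ℝ) :
    ∀ n : ℕ+, B < (n : ℕ) → background b g n = 0 := fun n hn => by
  rw [background, hb n hn, zero_div]

/-- The connected two-point function of sums of sheet currents, for `|ζ₁| > |ζ₂|`. -/
theorem ordered_sheetCurrents_isBigO {p q : ℕ} {b : ℕ+ → ℂ}
    (hb : ∀ n : ℕ+, p + q < (n : ℕ) → b n = 0) {Φ : ℝ → Bra →ₗ[ℂ] ℂ}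
    (hΦ : ∀ᶠ g in 𝓝[>] (0 : ℝ), Φ g 1 ≠ 0) {v : (ℕ+ →₀ ℕ) → ℕ → ℂ} (hv : HasGenusExpansion Φ v)
    (I J : Finset ℕ) {s t : ℕ} (hs : 1 ≤ s) (ht : 1 ≤ t) (m n : ℤ) :
    (fun g : ℝ => expect (Φ g) (∑ c ∈ J, sheetCurrent p (background b g) c t n
          (∑ a ∈ I, sheetCurrent p (background b g) a s m 1))
        - expect (Φ g) (∑ a ∈ I, sheetCurrent p (background b g) a s m 1)
          * expect (Φ g) (∑ c ∈ J, sheetCurrent p (background b g) c t n 1)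
        - ((s : ℂ) * (t : ℂ) / (g : ℂ) ^ (s + t - 2)) *
          coeff₂ Region.I (∑ a ∈ I, ∑ c ∈ J, leadingTerm p q b v Region.I s t a c) m n)
      =O[𝓝[>] 0] fun g : ℝ => g ^ (3 - (s : ℤ) - (t : ℤ)) := by
  -- The sheets range over arbitrary finite sets so that both the full currents and single sheets
  -- are covered, the latter for the annulus amplitude.
  choose K hK hA using fun a => exists_hasExp_sheetCurrent p hb v a s m
  choose K' hK' hA' using fun c => exists_hasExp_sheetCurrent p hb v c t n
  have hsumA := HasExp.sum I fun a _ => hA a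
  have hsumA' := HasExp.sum J fun c _ => hA' c
  have e : ∀ (S : Finset ℕ) (T : ℕ → Module.End ℂ Bra),
      (fun f => ∑ i ∈ S, T i f) = ⇑(∑ i ∈ S, T i) := fun S T => by
    funext f; rw [LinearMap.sum_apply]
  rw [e] at hsumA hsumA'
  have h1 := connected_isBigO hΦ hv hsumA hsumA' fun g =>
    { map_add := fun f f' => by
        simp only [(isLinearMap_sheetCurrent p (background_eq_zero hb g) _ t n).map_add,
          Finset.sum_add_distrib]
      map_smul := fun c f => by
        simp only [(isLinearMap_sheetCurrent p (background_eq_zero hb g) _ t n).map_smul,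
          Finset.smul_sum] }
  have hlead : (s : ℂ) * t *
      coeff₂ Region.I (∑ a ∈ I, ∑ c ∈ J, leadingTerm p q b v Region.I s t a c) m n =
      ∑ a ∈ I, ∑ c ∈ J, ∑ k ∈ Finset.Icc (-(0 : ℕ) : ℤ) (K a), sheetWeight p b v a s m k *
        ∑ l ∈ Finset.Icc (-(K a : ℤ)) (K' c), sheetWeight p b v c t n l * pairValue v k l := by
    have : coeff₂ Region.I (∑ a ∈ I, ∑ c ∈ J, leadingTerm p q b v Region.I s t a c) m n =
        ∑ a ∈ I, ∑ c ∈ J, coeff₂ Region.I (leadingTerm p q b v Region.I s t a c) m n := by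
      simp [coeff₂, HahnSeries.coeff_sum]
    rw [this, Finset.mul_sum]
    refine Finset.sum_congr rfl fun a _ => ?_
    rw [Finset.mul_sum]
    exact Finset.sum_congr rfl fun c _ =>
      coeff_leadingTerm hb v hs ht a c m n (hK a) (hK' c)
  have h2 : (fun g : ℝ => connPair Φ v g (∑ a ∈ I, fluct (K a) (sheetWeight p b v a s m))
        (∑ c ∈ J, fluct (K' c) (sheetWeight p b v c t n))
      - (s : ℂ) * t *
        coeff₂ Region.I (∑ a ∈ I, ∑ c ∈ J, leadingTerm p q b v Region.I s t a c) m n)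
      =O[𝓝[>] 0] fun g : ℝ => g := by
    simp only [hlead, connPair_sum, ← Finset.sum_sub_distrib]
    exact IsBigO.fun_sum fun a _ => IsBigO.fun_sum fun c _ =>
      connPair_fluct_isBigO hΦ hv (K a) (K' c) _ _
  have hg2 : (fun g : ℝ => (g : ℂ) ^ 2) =O[𝓝[>] 0] fun g : ℝ => g ^ 2 :=
    (isBigO_refl (fun g : ℝ => g ^ 2) _).norm_left.congr_left (fun g => by
      rw [norm_pow, norm_pow, Complex.norm_real]) |>.of_norm_left
  have h3 := h1.add ((hg2.mul h2).congr_right fun g => (pow_succ g 2).symm)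
  have hgi : (fun g : ℝ => ((g : ℂ) ^ (s + t))⁻¹) =O[𝓝[>] 0] fun g : ℝ => (g ^ (s + t))⁻¹ :=
    (isBigO_refl (fun g : ℝ => (g ^ (s + t))⁻¹) _).norm_left.congr_left (fun g => by
      rw [norm_inv, norm_inv, norm_pow, norm_pow, Complex.norm_real]) |>.of_norm_left
  refine (hgi.mul h3).congr' ?_ ?_
  · filter_upwards [self_mem_nhdsWithin] with g hg
    have hg0 : (g : ℂ) ≠ 0 := by exact_mod_cast (ne_of_gt hg)
    -- As s, t ≥ 1, the truncated difference s + t - 2 is genuine, and dividing by g^(s+t) turns g²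
    -- into the stated prefactor.
    obtain ⟨j, hj⟩ : ∃ j, s + t = j + 2 := ⟨s + t - 2, by omega⟩
    rw [hj, Nat.add_sub_cancel]
    field_simp
    ring
  · filter_upwards [self_mem_nhdsWithin] with g hg
    have hg0 : g ≠ 0 := ne_of_gt hg
    rw [← zpow_natCast, ← zpow_neg, ← zpow_natCast, ← zpow_add₀ hg0]
    congr 1
    push_cast
    ring

theorem radialConn_sheetCurrents_isBigO {p q : ℕ} {b : ℕ+ → ℂ}
    (hb : ∀ n : ℕ+, p + q < (n : ℕ) → b n = 0) {Φ : ℝ → Bra →ₗ[ℂ] ℂ}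
    (hΦ : ∀ᶠ g in 𝓝[>] (0 : ℝ), Φ g 1 ≠ 0) {v : (ℕ+ →₀ ℕ) → ℕ → ℂ} (hv : HasGenusExpansion Φ v)
    (I J : Finset ℕ) {s t : ℕ} (hs : 1 ≤ s) (ht : 1 ≤ t) (r : Region) (m n : ℤ) :
    (fun g : ℝ => radialConn r (Φ g)
        (fun m f => ∑ a ∈ I, sheetCurrent p (background b g) a s m f)
        (fun n f => ∑ c ∈ J, sheetCurrent p (background b g) c t n f) m n
        - ((s : ℂ) * (t : ℂ) / (g : ℂ) ^ (s + t - 2)) *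
          coeff₂ r (∑ a ∈ I, ∑ c ∈ J, leadingTerm p q b v r s t a c) m n)
      =O[𝓝[>] 0] fun g : ℝ => g ^ (3 - (s : ℤ) - (t : ℤ)) := by
  cases r with
  | I => exact ordered_sheetCurrents_isBigO hb hΦ hv I J hs ht m n
  | II =>
    have h := ordered_sheetCurrents_isBigO hb hΦ hv J I ht hs n m
    refine h.congr (fun g => ?_) fun g => ?_
    -- In this region the second current acts first, so the result for the first region applies with
    -- the two insertions exchanged.
    · have hc : coeff₂ Region.II (∑ a ∈ I, ∑ c ∈ J, leadingTerm p q b v Region.II s t a c) m n =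
          coeff₂ Region.I (∑ c ∈ J, ∑ a ∈ I, leadingTerm p q b v Region.I t s c a) n m := by
        simp only [leadingTerm_swap]
        rw [Finset.sum_comm]
        rfl
      rw [hc, radialConn, radial, mul_comm (expect _ _) (expect _ _), mul_comm (s : ℂ) t,
        add_comm s t]
    · congr 1
      ring

/-- For s = 1 the classical value is a coefficient of the disk amplitude itself, and the rest is g
times a bounded expectation value. -/
theorem tendsto_expect_sheetCurrent_one {p q : ℕ} {b : ℕ+ → ℂ}
    (hb : ∀ n : ℕ+, p + q < (n : ℕ) → b n = 0) {Φ : ℝ → Bra →ₗ[ℂ] ℂ}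
    (hΦ : ∀ᶠ g in 𝓝[>] (0 : ℝ), Φ g 1 ≠ 0) {v : (ℕ+ →₀ ℕ) → ℕ → ℂ} (hv : HasGenusExpansion Φ v)
    (a : ℕ) (m : ℤ) :
    Tendsto (fun g : ℝ => (g : ℂ) * expect (Φ g) (sheetCurrent p (background b g) a 1 m 1))
      (𝓝[>] 0) (𝓝 ((disk p q b v a).coeff m)) := by
  obtain ⟨K, -, e, h⟩ := exists_hasExp_sheetCurrent p hb v a 1 m
  obtain ⟨-, R, hR, H⟩ := h _ (const_mem_polyFamily 1)
  set T : Bra := fluct K (sheetWeight p b v a 1 m) 1 with hT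
  have hmem : (fun g : ℝ => (e • (1 : Bra) + T) + (g : ℂ) • R g) ∈ polyFamily :=
    polyFamily.add_mem (const_mem_polyFamily _) (coupling_smul_mem_polyFamily hR)
  have hbd := isBigO_one_of_mem_polyFamily (Ψ := shiftedExpect Φ v) (fun f => by
      simpa only [shiftedExpect_apply] using expect_shift_isBigO_one hΦ hv f) hmem
  have hg0 : Tendsto (fun g : ℝ => (g : ℂ)) (𝓝[>] 0) (𝓝 0) := by
    have := (Complex.continuous_ofReal.tendsto 0).mono_left (nhdsWithin_le_nhds (s := Set.Ioi 0))
    simpa using this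
  have hlim := (hbd.mul_isLittleO ((isLittleO_one_iff ℝ).mpr hg0))
  simp only [mul_one] at hlim
  have hlim' := ((isLittleO_one_iff ℝ).mp hlim).const_add ((disk p q b v a).coeff m)
  rw [add_zero] at hlim'
  refine hlim'.congr' ?_
  filter_upwards [hΦ, self_mem_nhdsWithin] with g hg hpos
  have hΨ1 := shiftedExpect_one (v := v) hg
  have H1 := congrArg (expectL (Φ g)) (H g (ne_of_gt hpos))
  have hconv : ∀ f, expectL (Φ g) (shift (onePoint v g) f) = shiftedExpect Φ v g f := fun f => rfl
  rw [hconv, map_one, map_smul, pow_one, expectL_apply, smul_eq_mul] at H1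
  have hd : (disk p q b v a).coeff m = (valueSeries p b v a 1 ^ 1).coeff (m - p * (1 : ℕ)) := by
    rw [disk_eq p q hb, HahnSeries.coeff_single_mul, one_mul, pow_one, Nat.cast_one, mul_one]
  rw [H1, hd]
  simp only [map_add, map_smul, hΨ1, smul_eq_mul]
  ring

lemma leadingTerm_one_one (p q : ℕ) (b : ℕ+ → ℂ) (v : (ℕ+ →₀ ℕ) → ℕ → ℂ) (r : Region) (a c : ℕ) :
    leadingTerm p q b v r 1 1 a c = ampA p v r a c := by
  have hone : ∀ f : Series₁, f ^ (1 - 1) = 1 := fun f => pow_zero f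
  have h1 : outer' 1 = 1 := by
    ext1
    funext m
    rw [outer', HahnSeries.map_coeff, HahnSeries.coeff_one, HahnSeries.coeff_one]
    split_ifs <;> simp
  have h2 : inner' 1 = 1 := map_one HahnSeries.C
  have h3 : at₁ r 1 = 1 := by cases r <;> assumption
  have h4 : at₂ r 1 = 1 := by cases r <;> assumption
  rw [leadingTerm, hone, hone, h3, h4]
  exact (mul_one (M := Series₂) _).trans (one_mul (M := Series₂) _)

lemma coeff₂_ampA (p : ℕ) (v : (ℕ+ →₀ ℕ) → ℕ → ℂ) (r : Region) (a c : ℕ) (m n : ℤ) :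
    coeff₂ r (ampA p v r a c) m n =
      coeff₂ r (annulus p v r a c) m n + coeff₂ r (deltaTerm p r a c) m n := by
  cases r <;> rfl

end

end MinimalString

end

theorem proposition4
    (p q : ℕ) (hp : 1 ≤ p)
    (b : ℕ+ → ℂ) (hb : ∀ n : ℕ+, p + q < (n : ℕ) → b n = 0)
    (Φ : ℝ → MinimalString.Bra →ₗ[ℂ] ℂ) (hΦ : ∀ᶠ g in 𝓝[>] (0 : ℝ), Φ g 1 ≠ 0)
    (v : (ℕ+ →₀ ℕ) → ℕ → ℂ) (hv : MinimalString.HasGenusExpansion Φ v) :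
    -- `disk` and `annulus` are the genus-zero parts of `⟨∂φₐ⟩` and of `⟨∂φₐ ∂φ_c⟩_c`
    (∀ a < p, ∀ m : ℤ,
      Tendsto (fun g : ℝ => (g : ℂ) * MinimalString.expect (Φ g)
          (MinimalString.sheetCurrent p (MinimalString.background b g) a 1 m 1))
        (𝓝[>] 0) (𝓝 ((MinimalString.disk p q b v a).coeff m))) ∧
    (∀ r : MinimalString.Region, ∀ a < p, ∀ c < p, ∀ m n : ℤ,
      Tendsto (fun g : ℝ => MinimalString.radialConn r (Φ g)
            (MinimalString.sheetCurrent p (MinimalString.background b g) a 1)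
            (MinimalString.sheetCurrent p (MinimalString.background b g) c 1) m n
          - MinimalString.coeff₂ r (MinimalString.deltaTerm p r a c) m n)
        (𝓝[>] 0) (𝓝 (MinimalString.coeff₂ r (MinimalString.annulus p v r a c) m n))) ∧
    -- the weak coupling limit of `⟨⟨Wˢ(ζ₁) Wᵗ(ζ₂)⟩⟩_c`
    ∀ s t : ℕ, 1 ≤ s → 1 ≤ t → ∀ r : MinimalString.Region,
      (∀ m n : ℤ,
        (fun g : ℝ => MinimalString.radialConn r (Φ g)
            (MinimalString.current p (MinimalString.background b g) s)
            (MinimalString.current p (MinimalString.background b g) t) m n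
          - ((s : ℂ) * (t : ℂ) / (g : ℂ) ^ (s + t - 2)) *
            MinimalString.coeff₂ r (∑ a ∈ Finset.range p, ∑ c ∈ Finset.range p,
              MinimalString.leadingTerm p q b v r s t a c) m n)
          =O[𝓝[>] 0] fun g : ℝ => g ^ (3 - (s : ℤ) - (t : ℤ))) ∧
      (∑ a ∈ Finset.range p, ∑ c ∈ Finset.range p,
          MinimalString.leadingTerm p q b v r s t a c)
        = (p : MinimalString.Series₂) ^ 2 *
          MinimalString.intPart₂ p (MinimalString.leadingTerm p q b v r s t 0 0) := by
  open MinimalString in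
  refine ⟨fun a _ m => tendsto_expect_sheetCurrent_one hb hΦ hv a m, fun r a _ c _ m n => ?_,
    fun s t hs ht r => ⟨fun m n => radialConn_sheetCurrents_isBigO hb hΦ hv (Finset.range p)
      (Finset.range p) hs ht r m n, sum_leadingTerm hp hb v r s t⟩⟩
  -- For single sheets and s = t = 1 the prefactor is 1, the leading term is A, and the error is
  -- O(g). Subtracting the δ term leaves the annulus amplitude.
  have h := MinimalString.radialConn_sheetCurrents_isBigO hb hΦ hv {a} {c} le_rfl le_rfl r m n
  have hlead : MinimalString.leadingTerm p q b v r 1 1 a c = MinimalString.ampA p v r a c :=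
    MinimalString.leadingTerm_one_one p q b v r a c
  simp only [Finset.sum_singleton, hlead] at h
  have hann := MinimalString.coeff₂_ampA p v r a c m n
  rw [hann] at h
  have hg : Tendsto (fun g : ℝ => g ^ (3 - ((1 : ℕ) : ℤ) - ((1 : ℕ) : ℤ))) (𝓝[>] 0) (𝓝 0) := by
    norm_num
    exact tendsto_id.mono_left nhdsWithin_le_nhds
  have hlim := (h.trans_tendsto hg).add_const
    (MinimalString.coeff₂ r (MinimalString.annulus p v r a c) m n)
  rw [zero_add] at hlim
  refine hlim.congr fun g => ?_
  norm_num
  ring
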